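/- Let $P_n=(n,n^2)\in\mathbb{R}^2$ for $n\in\mathbb{Z}$, let $Q^+$ be the convex hull of $\{P_n : n\in\mathbb{Z}\}$ and let $Q^-=-Q^+$. Let $S_1$ be the translation surface obtained from the disjoint union of $Q^+$ and $Q^-$ by identifying, for every $n\in\mathbb{Z}$, the edge $\overline{P_nP_{n+1}}$ of $Q^+$ with the edge $\overline{(-P_{n+1})(-P_n)}$ of $Q^-$ by the translation $p\mapsto p-(P_n+P_{n+1})$. Its singularities are the images of the vertices of the two polygons, and its area measure is Lebesgue measure on the two polygons. **Theorem (Recurrence).** The straight-line (geodesic) flow on $S_1$ in every direction of irrational slope is recurrent with respect to area. That is, let $v=(v_1,v_2)\in\mathbb{R}^2$ with $v_1\neq 0$ and $v_2/v_1$ irrational, and let $A\subseteq S_1$ be measurable. Then for almost every $x\in A$ the straight-line trajectory $\gamma:\mathbb{R}\to S_1$ with velocity $v$ and $\gamma(0)=x$ is defined for all times without meeting a singularity, and $\gamma(t)\in A$ for arbitrarily large positive $t$ and for arbitrarily large negative $t$. -/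

import Mathlib

open MeasureTheory Filter

namespace ParabolaSurface

/-- The integer points `(n, n²)` of the parabola `y = x²`. -/
def vertex (n : ℤ) : ℝ × ℝ := ((n : ℝ), (n : ℝ) ^ 2)

/-- The infinite polygon with vertices `(n, n²)`, `n ∈ ℤ`. -/
def upperPolygon : Set (ℝ × ℝ) := convexHull ℝ (Set.range vertex)

/-- The two polygons: `true` is the upper one, `false` is its image under the rotation by `π`
about the origin, that is, the convex hull of the points `(n, -n²)`. -/
def polygon (b : Bool) : Set (ℝ × ℝ) :=
  if b then upperPolygon else {p | -p ∈ upperPolygon}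

/-- The `n`-th edge of the upper polygon, joining `(n, n²)` to `(n + 1, (n + 1)²)`. -/
def edge (n : ℤ) : Set (ℝ × ℝ) := segment ℝ (vertex n) (vertex (n + 1))

/-- The disjoint union of the two polygons. -/
abbrev Pieces : Type := Σ b : Bool, polygon b

/-- Every edge `e` of the upper polygon is identified with its image `-e` in the lower polygon by
the translation that carries `e` to `-e`. For the `n`-th edge this is the translation by
`-(vertex n + vertex (n + 1))`, which sends `vertex n` to `-vertex (n + 1)` and `vertex (n + 1)`
to `-vertex n`. -/
def Glue (x y : Pieces) : Prop :=
  x.1 = true ∧ y.1 = false ∧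
    ∃ n : ℤ, (x.2 : ℝ × ℝ) ∈ edge n ∧
      (y.2 : ℝ × ℝ) = (x.2 : ℝ × ℝ) - (vertex n + vertex (n + 1))

/-- The translation surface `S₁`: the quotient of the two polygons by the equivalence relation
that the edge identifications generate. -/
def S₁ : Type := Quot Glue

/-- The point of the surface that is represented by a point of one of the polygons. -/
def proj (b : Bool) (p : polygon b) : S₁ := Quot.mk Glue ⟨b, p⟩

/-- A subset of `S₁` is measurable when its preimages in the two polygons are. -/
instance : MeasurableSpace S₁ := inferInstanceAs (MeasurableSpace (Quot Glue))

/-- The area measure of `S₁`: Lebesgue measure on each of the polygons. -/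
noncomputable def area : Measure S₁ :=
  Measure.sum fun b : Bool =>
    Measure.map (proj b) (Measure.comap (Subtype.val : polygon b → ℝ × ℝ) volume)

theorem nullMeasurableSet_polygon (b : Bool) :
    NullMeasurableSet (polygon b) (volume : Measure (ℝ × ℝ)) := by
  apply Convex.nullMeasurableSet
  cases b
  · have h : polygon false = (-LinearMap.id : (ℝ × ℝ) →ₗ[ℝ] ℝ × ℝ) ⁻¹' upperPolygon := by
      ext p
      simp [polygon]
    rw [h]
    exact (convex_convexHull ℝ _).linear_preimage _
  · simpa [polygon, upperPolygon] using convex_convexHull ℝ (Set.range vertex)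

theorem measurable_proj (b : Bool) : Measurable (proj b) :=
  measurable_quot_mk.comp fun _ hs => MeasurableSpace.measurableSet_iInf.1 hs b

/-- The area of a measurable set is the sum of the Lebesgue measures of its parts in the two
polygons. -/
theorem area_apply {A : Set S₁} (hA : MeasurableSet A) :
    area A = ∑ b : Bool, volume ((Subtype.val : polygon b → ℝ × ℝ) '' (proj b ⁻¹' A)) := by
  rw [area, Measure.sum_apply _ hA, tsum_fintype]
  refine Finset.sum_congr rfl fun b _ => ?_
  rw [Measure.map_apply (measurable_proj b) hA]
  refine Measure.comap_apply₀ _ _ Subtype.val_injective (fun s hs => ?_)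
    (measurable_proj b hA).nullMeasurableSet
  exact MeasureTheory.Measure.MeasurableSet.nullMeasurableSet_subtype_coe (nullMeasurableSet_polygon b) hs

/-- The cone singularities of `S₁`: the images of the vertices of the polygons. -/
def singularities : Set S₁ :=
  {x | ∃ (b : Bool) (p : polygon b), x = proj b p ∧
    ∃ n : ℤ, (p : ℝ × ℝ) = if b then vertex n else -vertex n}

/-- `γ` is a bi-infinite straight-line trajectory on `S₁` with velocity `v`: it avoids the
singularities, and just before and just after every time `t` it moves in one of the polygons along
a straight segment with velocity `v`. (The two polygons are different when `γ` crosses an edge at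
time `t`.) -/
def IsTrajectory (v : ℝ × ℝ) (γ : ℝ → S₁) : Prop :=
  ∀ t : ℝ, γ t ∉ singularities ∧ ∃ ε > (0 : ℝ),
    (∃ (b : Bool) (p : ℝ × ℝ), ∀ s ∈ Set.Icc (t - ε) t,
      ∃ h : p + (s - t) • v ∈ polygon b, γ s = proj b ⟨p + (s - t) • v, h⟩) ∧
    (∃ (b : Bool) (p : ℝ × ℝ), ∀ s ∈ Set.Icc t (t + ε),
      ∃ h : p + (s - t) • v ∈ polygon b, γ s = proj b ⟨p + (s - t) • v, h⟩)

/-- The straight-line flow with velocity `v` on `S₁` is recurrent (with respect to area): for every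
measurable set `A`, the trajectory of almost every point of `A` is defined for all times and is in
`A` at arbitrarily large positive times and at arbitrarily large negative times. -/
def IsRecurrent (v : ℝ × ℝ) : Prop :=
  ∀ A : Set S₁, MeasurableSet A → ∀ᵐ x ∂area, x ∈ A →
    ∃ γ : ℝ → S₁, IsTrajectory v γ ∧ γ 0 = x ∧
      (∃ᶠ t in atTop, γ t ∈ A) ∧ (∃ᶠ t in atBot, γ t ∈ A)

end ParabolaSurface

/-!
Chords of slopes `0` and `1` between vertices cut `S₁` into parallelograms. In suitable linear
coordinates these are rectangles of heights `|2 * n + 1|` and widths `2 * |n|` forming a staircase,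
and the direction of slope `α` becomes `(1 - α, α)`. Every horizontal cylinder of the staircase,
and every vertical one of positive width, is twice as long as it is wide. Therefore the first return
map of the flow to the left sides of the rectangles is unchanged when a multiple of `2 * x`
is added to `y` in the direction `(x, y)`, and reversing the sign of `y` only reflects it; the same
holds with the two coordinates exchanged. So the direction can be renormalised by the Euclidean
algorithm with even quotients.

Let `r` be its sequence of remainders. The block of the first `M + 1` rectangles has boundary flux
`(M + 1) * r 1`. Each renormalisation step costs one more rectangle, so after `k` steps the block is
contained in a region of finitely many rectangles with boundary flux `(k + M + 1) * r (k + 1)`.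
Since the differences of consecutive remainders are decreasing and summable, this is arbitrarily
small for some `k`. A wandering set meets such a region in measure at most the boundary flux, so the
flow is conservative, and conservativity gives both divergence of the lengths of the trajectories
and recurrence. The affine automorphisms of the parabola that permute the integer points reduce all
irrational slopes to slopes between `0` and `1`.
-/

open scoped ENNReal

namespace ParabolaSurface

/-! ### Conservative maps -/

section Conservative

variable {X : Type*} {T : X → X}

/-- The points whose orbit is in `S` at time `n` and in `R` at all earlier times. -/
def arrivals (T : X → X) (R S : Set X) (n : ℕ) : Set X :=
  {x | T^[n] x ∈ S ∧ ∀ m < n, T^[m] x ∈ R}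

@[simp]
theorem arrivals_zero (R S : Set X) : arrivals T R S 0 = S := by
  simp [arrivals]

theorem arrivals_succ (R S : Set X) (n : ℕ) :
    arrivals T R S (n + 1) = T ⁻¹' arrivals T R S n ∩ R := by
  ext x
  simp only [arrivals, Function.iterate_succ_apply, Set.mem_inter_iff, Set.mem_preimage,
    Set.mem_ofPred_eq, Nat.forall_lt_succ_left, Function.iterate_zero_apply]
  tauto

theorem arrivals_subset {R S : Set X} (hSR : S ⊆ R) (n : ℕ) : arrivals T R S n ⊆ R := by
  cases n with
  | zero => simpa using hSR
  | succ n => exact arrivals_succ (T := T) R S n ▸ Set.inter_subset_right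

theorem pairwise_disjoint_arrivals {W : Set X} (hW : ∀ x ∈ W, ∀ m ≠ 0, T^[m] x ∉ W) (R : Set X) :
    Pairwise (Function.onFun Disjoint (arrivals T R W)) := by
  refine (pairwise_disjoint_on _).2 fun i j hij => Set.disjoint_left.2 fun x hi hj => ?_
  apply hW _ hi.1 (j - i) (by omega)
  rw [← Function.iterate_add_apply, Nat.sub_add_cancel hij.le]
  exact hj.1

theorem preimage_iUnion_arrivals_diff_subset (A K : Set X) :
    T ⁻¹' (⋃ n, arrivals T Aᶜ K n) \ ⋃ n, arrivals T Aᶜ K n ⊆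
      (A \ K) ∩ T ⁻¹' ⋃ n, arrivals T Aᶜ K n := by
  rintro x ⟨hTx, hx⟩
  simp only [Set.mem_iUnion, not_exists] at hx
  refine ⟨⟨?_, fun hK => hx 0 (by simpa using hK)⟩, hTx⟩
  obtain ⟨n, hn⟩ := Set.mem_iUnion.1 hTx
  by_contra hA
  exact hx (n + 1) (by rw [arrivals_succ]; exact ⟨hn, hA⟩)

variable [MeasurableSpace X] {μ : Measure X}

theorem measurableSet_arrivals (hT : Measurable T) {R S : Set X} (hR : MeasurableSet R)
    (hS : MeasurableSet S) (n : ℕ) : MeasurableSet (arrivals T R S n) := by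
  induction n with
  | zero => simpa using hS
  | succ n ih => exact arrivals_succ (T := T) R S n ▸ (hT ih).inter hR

theorem measure_arrivals_add_sum (hT : MeasurePreserving T μ μ) {R S : Set X}
    (hR : MeasurableSet R) (hS : MeasurableSet S) (n : ℕ) :
    μ (arrivals T R S n) + ∑ i ∈ Finset.range n, μ (T ⁻¹' arrivals T R S i \ R) = μ S := by
  induction n with
  | zero => simp
  | succ n ih =>
    rw [← ih, Finset.sum_range_succ, arrivals_succ,
      ← hT.measure_preimage (measurableSet_arrivals hT.measurable hR hS n).nullMeasurableSet,
      ← measure_inter_add_sdiff (T ⁻¹' arrivals T R S n) hR]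
    ring

theorem tsum_measure_preimage_arrivals_diff_le (hT : MeasurePreserving T μ μ) {R S : Set X}
    (hR : MeasurableSet R) (hS : MeasurableSet S) :
    ∑' i, μ (T ⁻¹' arrivals T R S i \ R) ≤ μ S := by
  refine ENNReal.tsum_le_of_sum_range_le fun n => ?_
  rw [← measure_arrivals_add_sum hT hR hS n]
  exact le_add_self

theorem measure_diff_inter_preimage_arrivals_le (hT : MeasurePreserving T μ μ) {A K : Set X}
    (hA : MeasurableSet A) (hK : MeasurableSet K) :
    μ ((A \ K) ∩ T ⁻¹' ⋃ n, arrivals T Aᶜ K n) ≤ μ (T ⁻¹' K \ K) := by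
  set D := T ⁻¹' K \ K
  have hDm : MeasurableSet D := (hT.measurable hK).diff hK
  have hcover : (A \ K) ∩ (T ⁻¹' ⋃ n, arrivals T Aᶜ K n) ⊆
      (D ∩ A) ∪ ⋃ n, T ⁻¹' arrivals T Aᶜ (D \ A) n \ Aᶜ := by
    rintro x ⟨⟨hxA, hxK⟩, hTx⟩
    obtain ⟨n, hn, hlt⟩ := Set.mem_iUnion.1 hTx
    rw [← Function.iterate_succ_apply] at hn
    obtain ⟨j, hjn, hj, hj'⟩ : ∃ j ≤ n, T^[j] x ∉ K ∧ T^[j + 1] x ∈ K := by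
      by_contra! h
      have hout : ∀ j ≤ n + 1, T^[j] x ∉ K := fun j => by
        induction j with
        | zero => exact fun _ => hxK
        | succ j ih => exact fun hj => h j (by omega) (ih (by omega))
      exact hout (n + 1) le_rfl hn
    cases j with
    | zero => exact Or.inl ⟨⟨hj', hj⟩, hxA⟩
    | succ i =>
      refine Or.inr (Set.mem_iUnion.2 ⟨i, ⟨⟨⟨?_, ?_⟩, hlt i (by omega)⟩, fun m hm => ?_⟩, ?_⟩)
      · rwa [Set.mem_preimage, ← Function.iterate_succ_apply' T, ← Function.iterate_succ_apply]
      · rwa [← Function.iterate_succ_apply]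
      · exact hlt m (by omega)
      · exact fun h => h hxA
  calc μ ((A \ K) ∩ T ⁻¹' ⋃ n, arrivals T Aᶜ K n)
      ≤ μ (D ∩ A) + ∑' n, μ (T ⁻¹' arrivals T Aᶜ (D \ A) n \ Aᶜ) :=
        (measure_mono hcover).trans
          ((measure_union_le _ _).trans (add_le_add le_rfl (measure_iUnion_le _)))
    _ ≤ μ (D ∩ A) + μ (D \ A) :=
        add_le_add le_rfl (tsum_measure_preimage_arrivals_diff_le hT hA.compl (hDm.diff hA))
    _ = μ D := measure_inter_add_sdiff D hA

theorem measure_inter_le_of_wandering (hT : MeasurePreserving T μ μ) {W K : Set X}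
    (hW : MeasurableSet W) (hK : MeasurableSet K) (hfin : μ K ≠ ∞)
    (hwand : ∀ x ∈ W, ∀ m ≠ 0, T^[m] x ∉ W) :
    μ (W ∩ K) ≤ μ (T ⁻¹' K \ K) := by
  -- The pieces of the backward orbit of `W ∩ K` inside `K` are disjoint and of finite total
  -- measure, so their measures tend to zero and almost all of `W ∩ K` was entered from outside
  -- of `K`.
  have hm := measurableSet_arrivals hT.measurable hK (hW.inter hK)
  have hdisj : Pairwise (Function.onFun Disjoint (arrivals T K (W ∩ K))) :=
    pairwise_disjoint_arrivals (fun x hx m hm h => hwand x hx.1 m hm h.1) K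
  have hsub := arrivals_subset (T := T) (R := K) (S := W ∩ K) Set.inter_subset_right
  have hlim : Tendsto (fun n => μ (arrivals T K (W ∩ K) n)) atTop (nhds 0) := by
    refine ENNReal.tendsto_atTop_zero_of_tsum_ne_top ?_
    rw [← measure_iUnion hdisj hm]
    exact ne_top_of_le_ne_top hfin (measure_mono (Set.iUnion_subset hsub))
  have hexit (n : ℕ) :
      ∑ i ∈ Finset.range n, μ (T ⁻¹' arrivals T K (W ∩ K) i \ K) ≤ μ (T ⁻¹' K \ K) := by
    rw [← measure_biUnion_finset (fun i _ j _ hij => ((hdisj hij).preimage T).mono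
      Set.sdiff_subset Set.sdiff_subset) fun i _ => (hT.measurable (hm i)).diff hK]
    exact measure_mono (Set.iUnion₂_subset fun i _ =>
      Set.sdiff_subset_sdiff_left (Set.preimage_mono (hsub i)))
  have hbound : Tendsto (fun n => μ (arrivals T K (W ∩ K) n) + μ (T ⁻¹' K \ K)) atTop
      (nhds (μ (T ⁻¹' K \ K))) := by
    simpa only [zero_add] using hlim.add_const (μ (T ⁻¹' K \ K))
  refine ge_of_tendsto' hbound fun n => ?_
  rw [← measure_arrivals_add_sum hT hK (hW.inter hK) n]
  gcongr
  exact hexit n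

theorem conservative_of_almost_invariant (hT : MeasurePreserving T μ μ) (B : ℕ → Set X)
    (hB : ∀ᵐ x ∂μ, ∃ n, x ∈ B n)
    (h : ∀ n, ∀ ε : ℝ≥0∞, ε ≠ 0 →
      ∃ K, MeasurableSet K ∧ B n ⊆ K ∧ μ K ≠ ∞ ∧ μ (T ⁻¹' K \ K) ≤ ε) :
    Conservative T μ := by
  refine ⟨hT.quasiMeasurePreserving, fun W hW hpos => ?_⟩
  by_contra! hwand
  apply hpos
  have hnull (n : ℕ) : μ (W ∩ B n) = 0 := by
    by_contra hne
    obtain ⟨K, hK, hsub, hfin, hle⟩ := h n (μ (W ∩ B n) / 2) (by simpa using hne)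
    have hBK : μ (W ∩ B n) ≤ μ (W ∩ K) := measure_mono (Set.inter_subset_inter_right W hsub)
    have hhalf : μ (W ∩ B n) ≤ μ (W ∩ B n) / 2 :=
      hBK.trans ((measure_inter_le_of_wandering hT hW hK hfin hwand).trans hle)
    have htop : μ (W ∩ B n) ≠ ∞ :=
      ne_top_of_le_ne_top hfin (hBK.trans (measure_mono Set.inter_subset_right))
    exact hhalf.not_gt (ENNReal.half_lt_self hne htop)
  refine measure_mono_null_ae ?_ (measure_iUnion_null hnull)
  filter_upwards [hB] with x ⟨n, hn⟩ hxW using Set.mem_iUnion.2 ⟨n, hxW, hn⟩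

end Conservative

/-! ### Surfaces glued from rectangles -/

theorem volume_inter_Ioc_add {S : Set ℝ} (hS : MeasurableSet S) {a b c : ℝ} (hab : a ≤ b)
    (hbc : b ≤ c) :
    volume (S ∩ Set.Ioc a b) + volume (S ∩ Set.Ioc b c) = volume (S ∩ Set.Ioc a c) := by
  rw [← Set.Ioc_union_Ioc_eq_Ioc hab hbc, Set.inter_union_distrib_left,
    measure_union _ (hS.inter measurableSet_Ioc)]
  exact (Set.Ioc_disjoint_Ioc_of_le le_rfl).mono Set.inter_subset_right Set.inter_subset_right

/-- Combinatorial data of a translation surface glued from rectangles `[0, width j] × [0, height j]`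
along their sides: `right j` is the rectangle on the right of `j` and `top j` the one above it.
Since `right` and `top` are involutions, every rectangle lies in cylinders of at most two
rectangles. -/
structure Gluing (ι : Type*) where
  right : ι → ι
  top : ι → ι
  height : ι → ℝ
  width : ι → ℝ
  involutive_right : Function.Involutive right
  involutive_top : Function.Involutive top
  height_nonneg : ∀ j, 0 ≤ height j
  width_nonneg : ∀ j, 0 ≤ width j
  height_right : ∀ j, height (right j) = height j
  width_top : ∀ j, width (top j) = width j

namespace Gluing

variable {ι : Type*} (G : Gluing ι)

/-- The reflected surface, with the two coordinates exchanged. -/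
def swap : Gluing ι where
  right := G.top
  top := G.right
  height := G.width
  width := G.height
  involutive_right := G.involutive_top
  involutive_top := G.involutive_right
  height_nonneg := G.width_nonneg
  width_nonneg := G.height_nonneg
  height_right := G.width_top
  width_top := G.height_right

/-- The lines of direction `(x, y)` that meet the rectangles. The line through the point `(p, q)` of
the rectangle `j` is encoded as `(j, p * y - q * x)`, so the lines entering through the left side
are those with nonpositive second coordinate. -/
def strip (x y : ℝ) : Set (ι × ℝ) :=
  {z | -(G.height z.1 * x) < z.2 ∧ z.2 ≤ G.width z.1 * y}

/-- The lines of direction `(x, y)` that enter a rectangle through its left side. -/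
def left (x : ℝ) : Set (ι × ℝ) :=
  {z | -(G.height z.1 * x) < z.2 ∧ z.2 ≤ 0}

/-- The change of coordinates of a line that leaves a rectangle through its top side. -/
def exitTop (x : ℝ) : Equiv.Perm (ι × ℝ) where
  toFun z := (G.top z.1, z.2 + G.height z.1 * x)
  invFun z := (G.top z.1, z.2 - G.height (G.top z.1) * x)
  left_inv z := by simp [G.involutive_top z.1]
  right_inv z := by simp [G.involutive_top z.1]

/-- The change of coordinates of a line that leaves a rectangle through its right side. -/
def exitRight (y : ℝ) : Equiv.Perm (ι × ℝ) where
  toFun z := (G.right z.1, z.2 - G.width z.1 * y)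
  invFun z := (G.right z.1, z.2 + G.width (G.right z.1) * y)
  left_inv z := by simp [G.involutive_right z.1]
  right_inv z := by simp [G.involutive_right z.1]

/-- The passage of the flow of direction `(x, y)` through one rectangle. -/
noncomputable def step (x y : ℝ) (z : ι × ℝ) : ι × ℝ :=
  if G.width z.1 * y - G.height z.1 * x < z.2 then G.exitRight y z else G.exitTop x z

/-- The transverse measure of the flow of direction `(x, y)`. -/
noncomputable def flux [MeasurableSpace ι] (x y : ℝ) : Measure (ι × ℝ) :=
  (Measure.count.prod volume).restrict (G.strip x y)

variable {G} {x y : ℝ} {z : ι × ℝ}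

theorem exitTop_apply : G.exitTop x z = (G.top z.1, z.2 + G.height z.1 * x) := rfl

theorem exitRight_apply : G.exitRight y z = (G.right z.1, z.2 - G.width z.1 * y) := rfl

theorem step_of_lt (h : G.width z.1 * y - G.height z.1 * x < z.2) :
    G.step x y z = G.exitRight y z :=
  if_pos h

theorem step_of_le (h : z.2 ≤ G.width z.1 * y - G.height z.1 * x) :
    G.step x y z = G.exitTop x z :=
  if_neg h.not_gt

theorem left_subset_strip (hy : 0 ≤ y) : G.left x ⊆ G.strip x y :=
  fun z hz => ⟨hz.1, hz.2.trans (mul_nonneg (G.width_nonneg z.1) hy)⟩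

theorem mapsTo_step (hx : 0 ≤ x) (hy : 0 ≤ y) :
    Set.MapsTo (G.step x y) (G.strip x y) (G.strip x y) := by
  rintro z ⟨hlow, hup⟩
  have hheight := mul_nonneg (G.height_nonneg (G.top z.1)) hx
  have hwidth := mul_nonneg (G.width_nonneg (G.right z.1)) hy
  rcases lt_or_ge (G.width z.1 * y - G.height z.1 * x) z.2 with h | h
  · rw [step_of_lt h]
    simp only [strip, exitRight_apply, Set.mem_ofPred_eq, G.height_right]
    constructor <;> linarith
  · rw [step_of_le h]
    simp only [strip, exitTop_apply, Set.mem_ofPred_eq, G.width_top]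
    constructor <;> linarith

theorem exitTop_snd_pos (hz : z ∈ G.strip x y) : 0 < (G.exitTop x z).2 := by
  have hlow := hz.1
  simp only [exitTop_apply]
  linarith

theorem exitRight_snd_nonpos (hz : z ∈ G.strip x y) : (G.exitRight y z).2 ≤ 0 :=
  sub_nonpos.2 hz.2

theorem countable_graph [Countable ι] (f : ι → ℝ) : {z : ι × ℝ | z.2 = f z.1}.Countable :=
  (Set.countable_range fun j => (j, f j)).mono fun z hz =>
    Set.mem_range.2 ⟨z.1, Prod.ext rfl hz.symm⟩

section Measure

variable [MeasurableSpace ι] [DiscreteMeasurableSpace ι]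

theorem measurableSet_strip : MeasurableSet (G.strip x y) :=
  (measurableSet_lt (by fun_prop) measurable_snd).inter
    (measurableSet_le measurable_snd (by fun_prop))

theorem measurableSet_left : MeasurableSet (G.left x) :=
  (measurableSet_lt (by fun_prop) measurable_snd).inter
    (measurableSet_le measurable_snd measurable_const)

theorem measurable_step : Measurable (G.step x y) :=
  Measurable.ite (measurableSet_lt (by fun_prop) measurable_snd)
    (by unfold exitRight; dsimp; fun_prop) (by unfold exitTop; dsimp; fun_prop)

theorem ae_mem_strip : ∀ᵐ z ∂G.flux x y, z ∈ G.strip x y :=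
  ae_restrict_mem measurableSet_strip

theorem volume_preimage_step (hx : 0 ≤ x) (hy : 0 ≤ y) {B : Set (ι × ℝ)} (hB : MeasurableSet B)
    (j : ι) :
    volume (Prod.mk j ⁻¹' (G.step x y ⁻¹' B) ∩ Set.Ioc (-(G.height j * x)) (G.width j * y)) =
      volume (Prod.mk (G.right j) ⁻¹' B ∩ Set.Ioc (-(G.height (G.right j) * x)) 0) +
        volume (Prod.mk (G.top j) ⁻¹' B ∩ Set.Ioc 0 (G.width (G.top j) * y)) := by
  have hheight := mul_nonneg (G.height_nonneg j) hx
  have hwidth := mul_nonneg (G.width_nonneg j) hy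
  rw [← volume_inter_Ioc_add (measurable_prodMk_left (measurable_step hB))
    (by linarith : -(G.height j * x) ≤ G.width j * y - G.height j * x) (by linarith), add_comm,
    ← measure_preimage_add_right volume (-(G.width j * y)) (Prod.mk (G.right j) ⁻¹' B ∩ _),
    ← measure_preimage_add_right volume (G.height j * x) (Prod.mk (G.top j) ⁻¹' B ∩ _)]
  congr 2 <;> ext c
  · simp only [Set.mem_inter_iff, Set.mem_preimage, Set.mem_Ioc, G.height_right]
    have hstep (h : G.width j * y - G.height j * x < c) :
        G.step x y (j, c) = (G.right j, c + -(G.width j * y)) := step_of_lt h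
    grind
  · simp only [Set.mem_inter_iff, Set.mem_preimage, Set.mem_Ioc, G.width_top]
    have hstep (h : c ≤ G.width j * y - G.height j * x) :
        G.step x y (j, c) = (G.top j, c + G.height j * x) := step_of_le h
    grind

variable [Countable ι]

theorem flux_apply {B : Set (ι × ℝ)} (hB : MeasurableSet B) :
    G.flux x y B =
      ∑' j, volume (Prod.mk j ⁻¹' B ∩ Set.Ioc (-(G.height j * x)) (G.width j * y)) := by
  rw [flux, Measure.restrict_apply hB, Measure.prod_apply (hB.inter measurableSet_strip),
    lintegral_count]
  rfl

theorem count_prod_apply_of_countable {B : Set (ι × ℝ)} (hB : B.Countable) :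
    (Measure.count.prod (volume : Measure ℝ)) B = 0 := by
  rw [Measure.prod_apply hB.measurableSet, lintegral_count, ENNReal.tsum_eq_zero]
  exact fun j => (hB.preimage (Prod.mk_right_injective j)).measure_zero volume

theorem ae_ne_graph (f : ι → ℝ) : ∀ᵐ z ∂Measure.count.prod (volume : Measure ℝ), z.2 ≠ f z.1 := by
  simpa only [ae_iff, not_not] using count_prod_apply_of_countable (countable_graph f)

theorem ae_ne_flux (f : ι → ℝ) : ∀ᵐ z ∂G.flux x y, z.2 ≠ f z.1 :=
  ae_restrict_of_ae (ae_ne_graph f)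

theorem flux_apply_eq_add (hx : 0 ≤ x) (hy : 0 ≤ y) {B : Set (ι × ℝ)} (hB : MeasurableSet B) :
    G.flux x y B = ∑' j, volume (Prod.mk j ⁻¹' B ∩ Set.Ioc (-(G.height j * x)) 0) +
      ∑' j, volume (Prod.mk j ⁻¹' B ∩ Set.Ioc 0 (G.width j * y)) := by
  rw [flux_apply hB, ← ENNReal.tsum_add]
  exact tsum_congr fun j => (volume_inter_Ioc_add (measurable_prodMk_left hB)
    (neg_nonpos.2 (mul_nonneg (G.height_nonneg j) hx)) (mul_nonneg (G.width_nonneg j) hy)).symm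

theorem measurePreserving_step (hx : 0 ≤ x) (hy : 0 ≤ y) :
    MeasurePreserving (G.step x y) (G.flux x y) (G.flux x y) := by
  refine ⟨measurable_step, Measure.ext fun B hB => ?_⟩
  rw [Measure.map_apply measurable_step hB, flux_apply (measurable_step hB),
    flux_apply_eq_add hx hy hB]
  simp_rw [volume_preimage_step hx hy hB]
  rw [ENNReal.tsum_add]
  congr 1
  · exact Equiv.tsum_eq (G.involutive_right.toPerm G.right)
      fun j => volume (Prod.mk j ⁻¹' B ∩ Set.Ioc (-(G.height j * x)) 0)
  · exact Equiv.tsum_eq (G.involutive_top.toPerm G.top)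
      fun j => volume (Prod.mk j ⁻¹' B ∩ Set.Ioc 0 (G.width j * y))

theorem flux_ne_top {K : Set (ι × ℝ)} (hK : MeasurableSet K) (hfin : (Prod.fst '' K).Finite) :
    G.flux x y K ≠ ∞ := by
  rw [flux_apply hK, tsum_eq_sum (s := hfin.toFinset)]
  · exact (ENNReal.sum_lt_top.2 fun j _ =>
      (measure_mono Set.inter_subset_right).trans_lt measure_Ioc_lt_top).ne
  · intro j hj
    rw [Set.eq_empty_of_forall_notMem (s := Prod.mk j ⁻¹' K ∩ _), measure_empty]
    exact fun c hc => hj (hfin.mem_toFinset.2 ⟨(j, c), hc.1, rfl⟩)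

end Measure

/-! ### The first return to the left sides -/

variable {z' : ι × ℝ}

section LeftReturn

variable (G x y) in
/-- The relation between a line that enters through a left side and its next such entry `z'`, in a
form that also makes sense for directions of negative slope. Between the two entries the line leaves
`n` rectangles through the top side; for `0 < x` and `0 ≤ y` only `0 ≤ n` is possible. -/
def LeftReturn (z z' : ι × ℝ) : Prop :=
  z' ∈ G.left x ∧ ∃ n : ℤ, G.exitRight y ((G.exitTop x ^ n) z) = z'

variable (G x y) in
/-- The lines whose first entry through a left side, the present one included, is in `K`. -/
def leftBasin (K : Set (ι × ℝ)) : Set (ι × ℝ) :=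
  ⋃ n, arrivals (G.step x y) {z | z.2 ≤ 0}ᶜ K n

theorem exitTop_zpow_add_one (n : ℤ) :
    (G.exitTop x ^ (n + 1)) z = G.exitTop x ((G.exitTop x ^ n) z) := by
  rw [add_comm, zpow_one_add, Equiv.Perm.mul_apply]

theorem width_exitTop_zpow (n : ℤ) : G.width ((G.exitTop x ^ n) z).1 = G.width z.1 := by
  have hsucc (k : ℤ) :
      G.width ((G.exitTop x ^ (k + 1)) z).1 = G.width ((G.exitTop x ^ k) z).1 := by
    rw [exitTop_zpow_add_one, exitTop_apply, G.width_top]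
  induction n with
  | zero => rfl
  | succ n ih => rw [hsucc, ih]
  | pred n ih => rw [← ih, ← hsucc, sub_add_cancel]

theorem monotone_snd_exitTop_zpow (hx : 0 ≤ x) :
    Monotone fun n : ℤ => ((G.exitTop x ^ n) z).2 := by
  refine monotone_int_of_le_succ fun n => ?_
  rw [exitTop_zpow_add_one]
  exact le_add_of_nonneg_right (mul_nonneg (G.height_nonneg _) hx)

theorem step_eq_exitTop_of_pos (hz : z ∈ G.strip x y) (h : 0 < (G.step x y z).2) :
    G.step x y z = G.exitTop x z := by
  refine step_of_le (not_lt.1 fun hlt => h.not_ge ?_)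
  rw [step_of_lt hlt]
  exact exitRight_snd_nonpos hz

theorem step_eq_exitRight_of_nonpos (hz : z ∈ G.strip x y) (h : (G.step x y z).2 ≤ 0) :
    G.step x y z = G.exitRight y z := by
  refine step_of_lt (not_le.1 fun hle => h.not_gt ?_)
  rw [step_of_le hle]
  exact exitTop_snd_pos hz

theorem iterate_step_eq_exitTop_pow (hx : 0 ≤ x) (hy : 0 ≤ y) (hz : z ∈ G.strip x y) {n : ℕ}
    (h : ∀ m < n, 0 < ((G.step x y)^[m + 1] z).2) :
    (G.step x y)^[n] z = (G.exitTop x ^ n) z := by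
  induction n with
  | zero => rfl
  | succ n ih =>
    have hpos := h n n.lt_succ_self
    rw [Function.iterate_succ_apply'] at hpos ⊢
    rw [step_eq_exitTop_of_pos ((mapsTo_step hx hy).iterate n hz) hpos,
      ih fun m hm => h m (hm.trans n.lt_succ_self), pow_succ', Equiv.Perm.mul_apply]

theorem iterate_step_succ_eq (hx : 0 ≤ x) (hy : 0 ≤ y) (hz : z ∈ G.strip x y) {n : ℕ}
    (hpos : ∀ m < n, 0 < ((G.step x y)^[m + 1] z).2)
    (hnonpos : ((G.step x y)^[n + 1] z).2 ≤ 0) :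
    (G.step x y)^[n + 1] z = G.exitRight y ((G.exitTop x ^ n) z) := by
  rw [Function.iterate_succ_apply'] at hnonpos ⊢
  rw [step_eq_exitRight_of_nonpos ((mapsTo_step hx hy).iterate n hz) hnonpos,
    iterate_step_eq_exitTop_pow hx hy hz hpos]

theorem exists_leftReturn_of_step_mem_leftBasin (hx : 0 ≤ x) (hy : 0 ≤ y) {K : Set (ι × ℝ)}
    (hz : z ∈ G.strip x y)
    (h : G.step x y z ∈ G.leftBasin x y (K ∩ G.left x)) :
    ∃ z' ∈ K, G.LeftReturn x y z z' := by
  obtain ⟨n, ⟨hK, hleft⟩, hpos⟩ := Set.mem_iUnion.1 h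
  rw [← Function.iterate_succ_apply] at hK hleft
  have hreturn := iterate_step_succ_eq hx hy hz (n := n)
    (fun m hm => not_le.1 (hpos m hm)) hleft.2
  exact ⟨_, hK, hleft, n, hreturn.symm⟩

theorem LeftReturn.exists_nat (hx : 0 ≤ x) (hy : 0 ≤ y) (hz : z ∈ G.left x)
    (h : G.LeftReturn x y z z') : ∃ n : ℕ, G.exitRight y ((G.exitTop x ^ n) z) = z' := by
  obtain ⟨hleft, n, rfl⟩ := h
  suffices hn : 0 ≤ n by
    lift n to ℕ using hn
    exact ⟨n, rfl⟩
  by_contra! hneg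
  have hmono := monotone_snd_exitTop_zpow (G := G) (z := z) hx (Int.add_one_le_of_lt hneg)
  have hwidth := mul_nonneg (G.width_nonneg ((G.exitTop x ^ n) z).1) hy
  have hlow := hleft.1
  have hz0 := hz.2
  simp only [exitTop_zpow_add_one, exitTop_apply, zpow_zero, Equiv.Perm.one_apply] at hmono
  simp only [exitRight_apply, G.height_right] at hlow
  linarith

theorem iterate_step_eq_exitTop_pow_of_le (hx : 0 ≤ x) {n : ℕ}
    (h : ((G.exitTop x ^ n) z).2 ≤ G.width ((G.exitTop x ^ n) z).1 * y) {m : ℕ} (hmn : m ≤ n) :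
    (G.step x y)^[m] z = (G.exitTop x ^ m) z := by
  induction m with
  | zero => rfl
  | succ m ih =>
    rw [Function.iterate_succ_apply', ih (Nat.le_of_succ_le hmn), pow_succ', Equiv.Perm.mul_apply]
    refine step_of_le ?_
    have hmono := monotone_snd_exitTop_zpow (G := G) (z := z) hx (Int.ofNat_le.2 hmn)
    have hwm := width_exitTop_zpow (G := G) (x := x) (z := z) m
    have hwn := width_exitTop_zpow (G := G) (x := x) (z := z) n
    simp only [Int.natCast_succ, exitTop_zpow_add_one, exitTop_apply, zpow_natCast]
      at hmono hwm hwn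
    rw [hwn] at h
    rw [hwm]
    linarith

theorem LeftReturn.step_mem_leftBasin (hx : 0 ≤ x) (hy : 0 ≤ y) {K : Set (ι × ℝ)}
    (hz : z ∈ G.left x) (hz' : z' ∈ K) (h : G.LeftReturn x y z z') :
    G.step x y z ∈ G.leftBasin x y K := by
  obtain ⟨n, hn⟩ := h.exists_nat hx hy hz
  obtain ⟨hlow, hup⟩ := hn.symm ▸ h.1
  simp only [exitRight_apply, G.height_right] at hlow hup
  have hiter {m : ℕ} (hm : m ≤ n) : (G.step x y)^[m] z = (G.exitTop x ^ m) z :=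
    iterate_step_eq_exitTop_pow_of_le hx (sub_nonpos.1 hup) hm
  refine Set.mem_iUnion.2 ⟨n, ?_, fun m hm => ?_⟩
  · rw [← Function.iterate_succ_apply, Function.iterate_succ_apply', hiter le_rfl, step_of_lt, hn]
    · exact hz'
    · linarith
  · rw [← Function.iterate_succ_apply, hiter hm]
    have hmono := monotone_snd_exitTop_zpow (G := G) (z := z) hx
      (show (1 : ℤ) ≤ (m + 1 : ℕ) by omega)
    have hpos := exitTop_snd_pos (left_subset_strip hy hz)
    simp only [zpow_one, zpow_natCast] at hmono
    exact not_le.2 (hpos.trans_le hmono)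

end LeftReturn

section Shear

variable (G) in
/-- Every vertical cylinder of positive width is twice as high as it is wide, so that the shear
`(x, y) ↦ (x, y + 2 * x)` acts on the surface. -/
def HalfModulus : Prop :=
  ∀ j, G.height j + G.height (G.top j) = 2 * G.width j ∨ G.width j = 0

theorem exitTop_exitTop (hG : G.HalfModulus) (h : G.width z.1 ≠ 0) :
    G.exitTop x (G.exitTop x z) = (z.1, z.2 + 2 * G.width z.1 * x) := by
  have hsum := (hG z.1).resolve_right h
  refine Prod.ext (G.involutive_top z.1) ?_
  simp only [exitTop_apply]
  linear_combination x * hsum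

theorem exitTop_pow_two_mul (hG : G.HalfModulus) (h : G.width z.1 ≠ 0) (n : ℕ) :
    (G.exitTop x ^ (2 * n)) z = (z.1, z.2 + n * (2 * G.width z.1 * x)) := by
  induction n with
  | zero => simp
  | succ n ih =>
    rw [mul_add_one, add_comm, pow_add, Equiv.Perm.mul_apply, ih, pow_two, Equiv.Perm.mul_apply,
      exitTop_exitTop hG (z := (z.1, z.2 + n * (2 * G.width z.1 * x))) h]
    refine Prod.ext rfl ?_
    push_cast
    ring

theorem exitRight_exitTop_exitTop (hG : G.HalfModulus) (h : G.width z.1 ≠ 0) :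
    G.exitRight (y + 2 * x) (G.exitTop x (G.exitTop x z)) = G.exitRight y z := by
  rw [exitTop_exitTop hG h, exitRight_apply, exitRight_apply]
  refine Prod.ext rfl ?_
  ring

theorem exitRight_of_width_eq_zero (h : G.width z.1 = 0) :
    G.exitRight y z = (G.right z.1, z.2) := by
  simp [exitRight_apply, h]

theorem leftReturn_add_two_mul (hG : G.HalfModulus) :
    G.LeftReturn x (y + 2 * x) z z' ↔ G.LeftReturn x y z z' := by
  refine and_congr_right fun _ => ?_
  by_cases h : G.width z.1 = 0
  · refine exists_congr fun n => ?_
    have hn := (width_exitTop_zpow (x := x) n).trans h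
    rw [exitRight_of_width_eq_zero hn, exitRight_of_width_eq_zero hn]
  · refine (Equiv.addRight (2 : ℤ)).surjective.exists.trans (exists_congr fun n => ?_)
    have hn := (width_exitTop_zpow (x := x) n).trans_ne h
    rw [show Equiv.addRight 2 n = n + 1 + 1 from (add_assoc n 1 1).symm, exitTop_zpow_add_one,
      exitTop_zpow_add_one, exitRight_exitTop_exitTop hG hn]

theorem leftReturn_mul_add (hG : G.HalfModulus) (a : ℕ) :
    G.LeftReturn x (2 * a * x + y) z z' ↔ G.LeftReturn x y z z' := by
  induction a with
  | zero => simp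
  | succ a ih =>
    have hsucc : 2 * ((a + 1 : ℕ) : ℝ) * x + y = 2 * a * x + y + 2 * x := by
      push_cast
      ring
    rw [hsucc, leftReturn_add_two_mul hG, ih]

theorem exists_iterate_step_nonpos (hG : G.HalfModulus) (hx : 0 < x) (hy : 0 ≤ y)
    (hz : z ∈ G.strip x y) : ∃ n, ((G.step x y)^[n] z).2 ≤ 0 := by
  by_contra! h
  have hwidth : 0 < G.width z.1 := by
    refine (G.width_nonneg z.1).lt_of_ne fun h0 => ((h 0).trans_le hz.2).ne ?_
    rw [← h0, zero_mul]
  obtain ⟨n, hn⟩ := exists_nat_gt ((G.width z.1 * y - z.2) / (2 * G.width z.1 * x))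
  rw [div_lt_iff₀ (by positivity)] at hn
  have hup := ((mapsTo_step hx.le hy).iterate (2 * n) hz).2
  rw [iterate_step_eq_exitTop_pow hx.le hy hz fun m _ => h (m + 1),
    exitTop_pow_two_mul hG hwidth.ne'] at hup
  linarith

end Shear

section LeftBasin

variable {K : Set (ι × ℝ)} {s t : Set ι}

theorem measurableSet_leftBasin [MeasurableSpace ι] [DiscreteMeasurableSpace ι]
    (hK : MeasurableSet K) : MeasurableSet (G.leftBasin x y K) :=
  .iUnion fun n => measurableSet_arrivals measurable_step
    (measurableSet_le measurable_snd measurable_const).compl hK n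

theorem fst_exitTop_pow (n : ℕ) :
    ((G.exitTop x ^ n) z).1 = z.1 ∨ ((G.exitTop x ^ n) z).1 = G.top z.1 := by
  induction n with
  | zero => exact Or.inl rfl
  | succ n ih =>
    rw [pow_succ', Equiv.Perm.mul_apply, exitTop_apply]
    rcases ih with h | h <;> simp [h, G.involutive_top z.1]

theorem finite_fst_leftBasin (hx : 0 ≤ x) (hy : 0 ≤ y) (hK : (Prod.fst '' K).Finite) :
    (Prod.fst '' (G.leftBasin x y (K ∩ G.left x) ∩ G.strip x y)).Finite := by
  have hright := hK.preimage (f := G.right) G.involutive_right.injective.injOn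
  refine (hK.union (hright.union (hright.preimage (f := G.top)
    G.involutive_top.injective.injOn))).subset ?_
  rintro _ ⟨z, ⟨hzU, hz⟩, rfl⟩
  obtain ⟨n, ⟨hzK, hleft⟩, hpos⟩ := Set.mem_iUnion.1 hzU
  cases n with
  | zero => exact Or.inl ⟨z, hzK, rfl⟩
  | succ n =>
    rw [iterate_step_succ_eq hx hy hz (fun m hm => not_le.1 (hpos (m + 1) (by omega))) hleft.2]
      at hzK
    rcases fst_exitTop_pow (G := G) (x := x) (z := z) n with h | h
    · exact Or.inr (Or.inl ⟨_, hzK, congrArg G.right h⟩)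
    · exact Or.inr (Or.inr ⟨_, hzK, congrArg G.right h⟩)

theorem mem_leftBasin (hG : G.HalfModulus) (hx : 0 < x) (hy : 0 ≤ y) (hst : s ⊆ t)
    (htop : Set.MapsTo G.top s s) (hright : Set.MapsTo G.right s t) (hsub : Prod.fst ⁻¹' t ⊆ K)
    (hz : z ∈ G.strip x y) (hzs : z.1 ∈ s) : z ∈ G.leftBasin x y (K ∩ G.left x) := by
  classical
  have hex := exists_iterate_step_nonpos hG hx hy hz
  have hmin {m : ℕ} (hm : m < Nat.find hex) : 0 < ((G.step x y)^[m] z).2 :=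
    not_le.1 (Nat.find_min hex hm)
  have hleft : (G.step x y)^[Nat.find hex] z ∈ G.left x :=
    ⟨((mapsTo_step hx.le hy).iterate _ hz).1, Nat.find_spec hex⟩
  refine Set.mem_iUnion.2 ⟨Nat.find hex, ⟨hsub ?_, hleft⟩, fun m hm => not_le.2 (hmin hm)⟩
  rcases h : Nat.find hex with _ | n
  · exact hst hzs
  rw [h] at hmin hleft
  rw [Set.mem_preimage,
    iterate_step_succ_eq hx.le hy hz (fun m hm => hmin (by omega)) hleft.2, exitRight_apply]
  rcases fst_exitTop_pow (G := G) (x := x) (z := z) n with hfst | hfst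
  · exact hright (hfst ▸ hzs)
  · exact hright (hfst ▸ htop hzs)

end LeftBasin

section Reflection

variable (G) in
/-- The vertical reflection of the left sides, which exchanges the directions `(x, y)` and
`(x, -y)`. -/
noncomputable def reflectLeft (x : ℝ) : Equiv.Perm (ι × ℝ) :=
  Function.Involutive.toPerm (fun z => (z.1, -(G.height z.1 * x) - z.2)) fun z => by simp

theorem reflectLeft_apply : G.reflectLeft x z = (z.1, -(G.height z.1 * x) - z.2) := rfl

theorem reflectLeft_mem_left (hz : z ∈ G.left x) (h : z.2 ≠ 0) : G.reflectLeft x z ∈ G.left x := by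
  have hneg := lt_of_le_of_ne hz.2 h
  have hlow := hz.1
  simp only [left, reflectLeft_apply, Set.mem_ofPred_eq]
  constructor <;> linarith

theorem reflectLeft_mul_exitTop :
    G.reflectLeft x * G.exitTop x = (G.exitTop x)⁻¹ * G.reflectLeft x := by
  rw [eq_inv_mul_iff_mul_eq]
  refine Equiv.ext fun z => Prod.ext (G.involutive_top z.1) ?_
  simp only [Equiv.Perm.mul_apply, reflectLeft_apply, exitTop_apply]
  ring

theorem reflectLeft_mul_exitRight :
    G.reflectLeft x * G.exitRight y = G.exitRight (-y) * G.reflectLeft x := by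
  refine Equiv.ext fun z => Prod.ext rfl ?_
  simp only [Equiv.Perm.mul_apply, reflectLeft_apply, exitRight_apply, G.height_right]
  ring

theorem LeftReturn.reflect (h : G.LeftReturn x y z z') (hz' : G.reflectLeft x z' ∈ G.left x) :
    G.LeftReturn x (-y) (G.reflectLeft x z) (G.reflectLeft x z') := by
  obtain ⟨-, n, rfl⟩ := h
  have hsemi := SemiconjBy.zpow_right (reflectLeft_mul_exitTop (G := G) (x := x)) n
  have hperm : G.exitRight (-y) * (G.exitTop x ^ (-n) * G.reflectLeft x) =
      G.reflectLeft x * (G.exitRight y * G.exitTop x ^ n) := by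
    rw [← mul_assoc (G.reflectLeft x), reflectLeft_mul_exitRight, mul_assoc, hsemi.eq, inv_zpow']
  exact ⟨hz', -n, Equiv.congr_fun hperm z⟩

theorem countable_leftReturn_zero [Countable ι] :
    {z | ∃ z', z'.2 = 0 ∧ G.LeftReturn x y z z'}.Countable := by
  have hcount (n : ℤ) :
      ((fun z => G.exitRight y ((G.exitTop x ^ n) z)) ⁻¹' {z | z.2 = 0}).Countable :=
    (countable_graph fun _ => 0).preimage
      ((G.exitRight y).injective.comp (G.exitTop x ^ n).injective)
  refine (Set.countable_iUnion hcount).mono ?_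
  rintro z ⟨z', hz', -, n, hn⟩
  exact Set.mem_iUnion.2 ⟨n, (congrArg Prod.snd hn).trans hz'⟩

theorem measurePreserving_reflectLeft [MeasurableSpace ι] [DiscreteMeasurableSpace ι]
    [Countable ι] :
    MeasurePreserving (G.reflectLeft x) (Measure.count.prod volume) (Measure.count.prod volume) :=
  (MeasurePreserving.id _).skew_product
    (g := fun j c => -(G.height j * x) - c) (by unfold Function.uncurry; fun_prop)
    (ae_of_all _ fun j => (Measure.measurePreserving_sub_left volume _).map_eq)

end Reflection

/-! ### Regions with almost no flux through the boundary -/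

section AlmostInvariant

variable [MeasurableSpace ι] {s t : Set ι} {ε : ℝ≥0∞}

variable (G x y s ε) in
/-- The rectangles of `s` are contained in a part of finitely many rectangles that the flow of
direction `(x, y)` enters with flux at most `ε`. -/
def AlmostInvariant : Prop :=
  ∃ K : Set (ι × ℝ), MeasurableSet K ∧ (Prod.fst '' K).Finite ∧ Prod.fst ⁻¹' s ⊆ K ∧
    G.flux x y (G.step x y ⁻¹' K \ K) ≤ ε

variable (G x y s ε) in
/-- The analogue of `AlmostInvariant` for the first return to the left sides. -/
def AlmostInvariantLeft : Prop :=
  ∃ K : Set (ι × ℝ), MeasurableSet K ∧ (Prod.fst '' K).Finite ∧ Prod.fst ⁻¹' s ⊆ K ∧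
    Measure.count.prod volume {z ∈ G.left x \ K | ∃ z' ∈ K, G.LeftReturn x y z z'} ≤ ε

theorem AlmostInvariant.mono {δ : ℝ≥0∞} (hst : s ⊆ t) (hδε : δ ≤ ε)
    (h : G.AlmostInvariant x y t δ) : G.AlmostInvariant x y s ε :=
  let ⟨K, hK, hfin, hsub, hle⟩ := h
  ⟨K, hK, hfin, (Set.preimage_mono hst).trans hsub, hle.trans hδε⟩

theorem AlmostInvariantLeft.mul_add (hG : G.HalfModulus) (a : ℕ)
    (h : G.AlmostInvariantLeft x y s ε) : G.AlmostInvariantLeft x (2 * a * x + y) s ε := by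
  simpa only [AlmostInvariantLeft, leftReturn_mul_add hG] using h

variable [DiscreteMeasurableSpace ι]

theorem AlmostInvariantLeft.almostInvariant (hG : G.HalfModulus) (hx : 0 < x) (hy : 0 ≤ y)
    (hs : s.Finite) (hst : s ⊆ t) (htop : Set.MapsTo G.top s s) (hright : Set.MapsTo G.right s t)
    (h : G.AlmostInvariantLeft x y t ε) : G.AlmostInvariant x y s ε := by
  obtain ⟨K, hK, hfin, hsub, hle⟩ := h
  set U := G.leftBasin x y (K ∩ G.left x)
  have hcover {z : ι × ℝ} (hz : z ∈ G.strip x y) (hzs : z.1 ∈ s) : z ∈ U :=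
    mem_leftBasin hG hx hy hst htop hright hsub hz hzs
  refine ⟨U ∩ G.strip x y ∪ Prod.fst ⁻¹' s,
    ((measurableSet_leftBasin (hK.inter measurableSet_left)).inter measurableSet_strip).union
      (measurable_fst .of_discrete), ?_, Set.subset_union_right, le_trans ?_ hle⟩
  · rw [Set.image_union]
    refine (finite_fst_leftBasin hx.le hy hfin).union (hs.subset ?_)
    exact Set.image_preimage_subset Prod.fst s
  rw [flux, Measure.restrict_apply' measurableSet_strip]
  refine measure_mono ?_
  rintro z ⟨⟨hTz, hzV⟩, hz⟩
  simp only [Set.mem_union, Set.mem_inter_iff, not_or, not_and] at hzV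
  have hTU : G.step x y z ∈ U := hTz.elim And.left (hcover (mapsTo_step hx.le hy hz))
  obtain ⟨⟨hleft, hzK⟩, -⟩ := preimage_iUnion_arrivals_diff_subset _ _ ⟨hTU, fun h => hzV.1 h hz⟩
  exact ⟨⟨⟨hz.1, hleft⟩, fun h => hzK ⟨h, hz.1, hleft⟩⟩,
    exists_leftReturn_of_step_mem_leftBasin hx.le hy hz hTU⟩

variable [Countable ι]

theorem AlmostInvariant.left (hx : 0 ≤ x) (hy : 0 ≤ y) (h : G.AlmostInvariant x y s ε) :
    G.AlmostInvariantLeft x y s ε := by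
  obtain ⟨K, hK, hfin, hsub, hle⟩ := h
  have hexit := measure_diff_inter_preimage_arrivals_le (measurePreserving_step (G := G) hx hy)
    (measurableSet_le measurable_snd measurable_const : MeasurableSet {z : ι × ℝ | z.2 ≤ 0}) hK
  refine ⟨K, hK, hfin, hsub, le_trans ?_ (hexit.trans hle)⟩
  rw [flux, Measure.restrict_apply' measurableSet_strip]
  refine measure_mono ?_
  rintro z ⟨⟨hz, hzK⟩, z', hz', hreturn⟩
  exact ⟨⟨⟨hz.2, hzK⟩, hreturn.step_mem_leftBasin hx hy hz hz'⟩, left_subset_strip hy hz⟩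

theorem AlmostInvariantLeft.neg (h : G.AlmostInvariantLeft x y s ε) :
    G.AlmostInvariantLeft x (-y) s ε := by
  obtain ⟨K, hK, hfin, hsub, hle⟩ := h
  refine ⟨G.reflectLeft x ⁻¹' K, measurePreserving_reflectLeft.measurable hK,
    hfin.subset ?_, fun z hz => hsub hz, le_trans ?_ hle⟩
  · rintro _ ⟨z, hz, rfl⟩
    exact ⟨_, hz, rfl⟩
  set B := {z ∈ G.left x \ K | ∃ z' ∈ K, G.LeftReturn x y z z'}
  have hcover : {z ∈ G.left x \ G.reflectLeft x ⁻¹' K |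
      ∃ z' ∈ G.reflectLeft x ⁻¹' K, G.LeftReturn x (-y) z z'} ⊆ G.reflectLeft x ⁻¹' B ∪
        ({z | z.2 = 0} ∪ {z | ∃ z', z'.2 = 0 ∧ G.LeftReturn x (-y) z z'}) := by
    rintro z ⟨⟨hz, hzK⟩, z', hz', hreturn⟩
    by_cases hz0 : z.2 = 0
    · exact Or.inr (Or.inl hz0)
    by_cases hz0' : z'.2 = 0
    · exact Or.inr (Or.inr ⟨z', hz0', hreturn⟩)
    refine Or.inl ⟨⟨reflectLeft_mem_left hz hz0, hzK⟩, _, hz', ?_⟩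
    simpa only [neg_neg] using hreturn.reflect (reflectLeft_mem_left hreturn.1 hz0')
  have hnull := count_prod_apply_of_countable
    ((countable_graph fun _ : ι => 0).union (countable_leftReturn_zero (G := G) (x := x) (y := -y)))
  calc _ ≤ Measure.count.prod volume (G.reflectLeft x ⁻¹' B) + 0 :=
        (measure_mono hcover).trans ((measure_union_le _ _).trans (add_le_add le_rfl hnull.le))
    _ ≤ Measure.count.prod volume B := by
        rw [add_zero]
        conv_rhs => rw [← (measurePreserving_reflectLeft (G := G) (x := x)).map_eq]
        exact Measure.le_map_apply measurePreserving_reflectLeft.aemeasurable B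

theorem AlmostInvariant.mul_add (hG : G.HalfModulus) (hx : 0 < x) (hy : 0 ≤ y) (hs : s.Finite)
    (hst : s ⊆ t) (htop : Set.MapsTo G.top s s) (hright : Set.MapsTo G.right s t) (a : ℕ)
    (h : G.AlmostInvariant x y t ε) : G.AlmostInvariant x (2 * a * x + y) s ε :=
  ((h.left hx.le hy).mul_add hG a).almostInvariant hG hx (by positivity) hs hst htop hright

theorem AlmostInvariant.mul_sub (hG : G.HalfModulus) (hx : 0 < x) (hy : 0 ≤ y) (hs : s.Finite)
    (hst : s ⊆ t) (htop : Set.MapsTo G.top s s) (hright : Set.MapsTo G.right s t) {a : ℕ}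
    (ha : 0 ≤ 2 * a * x - y) (h : G.AlmostInvariant x y t ε) :
    G.AlmostInvariant x (2 * a * x - y) s ε :=
  ((h.left hx.le hy).neg.mul_add hG a).almostInvariant hG hx ha hs hst htop hright

theorem measurePreserving_swap :
    MeasurePreserving (fun z : ι × ℝ => (z.1, -z.2)) (G.swap.flux y x) (G.flux x y) := by
  have hneg : MeasurePreserving (fun z : ι × ℝ => (z.1, -z.2))
      (Measure.count.prod volume) (Measure.count.prod volume) :=
    (MeasurePreserving.id _).skew_product (g := fun _ c => -c)
      (by unfold Function.uncurry; fun_prop)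
      (ae_of_all _ fun _ => (Measure.measurePreserving_neg volume).map_eq)
  have hstrip : G.swap.strip y x =ᵐ[Measure.count.prod volume]
      (fun z : ι × ℝ => (z.1, -z.2)) ⁻¹' G.strip x y := by
    filter_upwards [ae_ne_graph fun j => -(G.width j * y), ae_ne_graph fun j => G.height j * x]
      with z hlow hup
    refine propext ⟨fun hz => ⟨?_, ?_⟩, fun hz => ⟨?_, ?_⟩⟩
    · exact neg_lt_neg (lt_of_le_of_ne hz.2 hup)
    · exact neg_le.1 hz.1.le
    · exact lt_of_le_of_ne (neg_le.1 hz.2) hlow.symm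
    · exact (neg_lt_neg_iff.1 hz.1).le
  rw [flux, Measure.restrict_congr_set hstrip]
  exact hneg.restrict_preimage measurableSet_strip

theorem ae_step_swap :
    ∀ᵐ z ∂G.swap.flux y x, (fun z : ι × ℝ => (z.1, -z.2)) (G.swap.step y x z) =
      G.step x y (z.1, -z.2) := by
  filter_upwards [ae_ne_flux fun j => G.height j * x - G.width j * y] with z hz
  rcases lt_or_gt_of_ne hz with h | h
  · have h' : G.width z.1 * y - G.height z.1 * x < -z.2 := by linarith
    rw [step_of_le (G := G.swap) h.le, step_of_lt (G := G) (z := (z.1, -z.2)) h']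
    exact Prod.ext rfl (neg_add' z.2 (G.width z.1 * y))
  · have h' : -z.2 ≤ G.width z.1 * y - G.height z.1 * x := by linarith
    rw [step_of_lt (G := G.swap) h, step_of_le (G := G) (z := (z.1, -z.2)) h']
    exact Prod.ext rfl ((neg_sub' _ _).trans (sub_neg_eq_add _ _))

theorem AlmostInvariant.swap (h : G.AlmostInvariant x y s ε) :
    G.swap.AlmostInvariant y x s ε := by
  obtain ⟨K, hK, hfin, hsub, hle⟩ := h
  have hpres := measurePreserving_swap (G := G) (x := x) (y := y)
  refine ⟨_, hpres.measurable hK, hfin.subset ?_, fun z hz => hsub hz, le_trans ?_ hle⟩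
  · rintro _ ⟨z, hz, rfl⟩
    exact ⟨_, hz, rfl⟩
  rw [← hpres.measure_preimage ((measurable_step hK).diff hK).nullMeasurableSet]
  refine measure_mono_ae ?_
  filter_upwards [ae_step_swap (G := G) (x := x) (y := y)] with z hz hmem
  exact ⟨hz.subst (motive := (· ∈ K)) hmem.1, hmem.2⟩

theorem flux_inter_left_le {k : ι} :
    G.flux x y {z | z.1 = k ∧ z.2 ≤ 0} ≤ ENNReal.ofReal (G.height k * x) := by
  have hmeas : MeasurableSet {z : ι × ℝ | z.1 = k ∧ z.2 ≤ 0} :=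
    (measurable_fst (.singleton k)).inter (measurableSet_le measurable_snd measurable_const)
  rw [flux_apply hmeas, tsum_eq_single k fun j hj => by simp [hj]]
  calc _ ≤ volume (Set.Ioc (-(G.height k * x)) 0) :=
        measure_mono fun c hc => ⟨hc.2.1, hc.1.2⟩
    _ = ENNReal.ofReal (G.height k * x) := by rw [Real.volume_Ioc, zero_sub, neg_neg]

theorem almostInvariant_of_forall_right_mem (hx : 0 ≤ x) (hy : 0 ≤ y) (hs : s.Finite)
    (htop : Set.MapsTo G.top s s) {k : ι} (hright : ∀ j ∈ s, G.right j ∈ s ∨ j = k) :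
    G.AlmostInvariant x y s (ENNReal.ofReal (G.height k * x)) := by
  have hmeas : MeasurableSet {z : ι × ℝ | z.1 = k ∧ z.2 ≤ 0} :=
    (measurable_fst (.singleton k)).inter (measurableSet_le measurable_snd measurable_const)
  refine ⟨Prod.fst ⁻¹' s, measurable_fst .of_discrete, hs.subset (Set.image_preimage_subset _ _),
    subset_rfl, le_trans ?_ (flux_inter_left_le (x := x) (y := y))⟩
  rw [← (measurePreserving_step hx hy).measure_preimage hmeas.nullMeasurableSet]
  refine measure_mono_ae ?_
  filter_upwards [ae_mem_strip] with z hz ⟨hTz, hzs⟩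
  rcases lt_or_ge (G.width z.1 * y - G.height z.1 * x) z.2 with h | h
  · rw [Set.mem_preimage, Set.mem_preimage, step_of_lt h] at hTz
    change G.step x y z ∈ {z | z.1 = k ∧ z.2 ≤ 0}
    rw [step_of_lt h]
    refine ⟨(hright _ hTz).resolve_left fun hmem => hzs ?_, exitRight_snd_nonpos hz⟩
    simpa [exitRight_apply, G.involutive_right z.1] using hmem
  · rw [Set.mem_preimage, Set.mem_preimage, step_of_le h] at hTz
    exact absurd (by simpa [exitTop_apply, G.involutive_top z.1] using htop hTz) hzs

end AlmostInvariant

end Gluing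

/-! ### The even Euclidean algorithm -/

theorem mul_sub_succ_le_sub {r : ℕ → ℝ} (hd : Antitone fun k => r k - r (k + 1)) (n m : ℕ) :
    m * (r (n + m) - r (n + m + 1)) ≤ r n - r (n + m) := by
  induction m with
  | zero => simp
  | succ m ih =>
    have hstep : (m + 1) * (r (n + m + 1) - r (n + m + 1 + 1)) ≤
        (m + 1) * (r (n + m) - r (n + m + 1)) :=
      mul_le_mul_of_nonneg_left (hd (n + m).le_succ) (by positivity)
    rw [← add_assoc]
    push_cast
    linarith

theorem tendsto_mul_sub_succ {r : ℕ → ℝ} {L : ℝ} (hr : Tendsto r atTop (nhds L))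
    (hanti : Antitone r) (hd : Antitone fun k => r k - r (k + 1)) :
    Tendsto (fun k : ℕ => k * (r k - r (k + 1))) atTop (nhds 0) := by
  have hhalf : Tendsto (fun k : ℕ => 2 * (r (k / 2) - r k)) atTop (nhds 0) := by
    simpa using ((hr.comp (Nat.tendsto_div_const_atTop two_ne_zero)).sub hr).const_mul 2
  have hnonneg (k : ℕ) : 0 ≤ r k - r (k + 1) := sub_nonneg.2 (hanti k.le_succ)
  refine squeeze_zero (fun k => mul_nonneg k.cast_nonneg (hnonneg k)) (fun k => ?_) hhalf
  have hle := mul_sub_succ_le_sub hd (k / 2) (k - k / 2)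
  rw [Nat.add_sub_cancel' (Nat.div_le_self k 2)] at hle
  calc k * (r k - r (k + 1)) ≤ 2 * (k - k / 2 : ℕ) * (r k - r (k + 1)) :=
        mul_le_mul_of_nonneg_right (by exact_mod_cast (by omega : k ≤ 2 * (k - k / 2))) (hnonneg k)
    _ ≤ 2 * (r (k / 2) - r k) := by linarith

/-- `r` is the sequence of remainders of the Euclidean algorithm with even quotients and remainders
of either sign. It is the algorithm that the surface admits, since its shears are by even
numbers. -/
def IsEvenEuclid (r : ℕ → ℝ) : Prop :=
  ∀ k, 0 < r (k + 1) ∧ r (k + 1) < r k ∧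
    ∃ a : ℕ, 1 ≤ a ∧
      (r k = 2 * a * r (k + 1) + r (k + 2) ∨ r k = 2 * a * r (k + 1) - r (k + 2))

theorem exists_abs_sub_even_lt_one {t : ℝ} (ht : 1 < t) (h : Irrational t) :
    ∃ a : ℕ, 1 ≤ a ∧ 0 < |t - 2 * a| ∧ |t - 2 * a| < 1 ∧ Irrational |t - 2 * a| := by
  have hround := abs_sub_round (t / 2)
  have hpos : (0 : ℝ) < round (t / 2) := by linarith [(abs_le.1 hround).2]
  obtain ⟨a, ha⟩ := Int.eq_ofNat_of_zero_le (Int.cast_pos.1 hpos).le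
  have hirr : Irrational (t - 2 * a) := by exact_mod_cast h.sub_natCast (2 * a)
  rw [ha, Int.cast_natCast] at hround hpos
  have habs : Irrational |t - 2 * a| := by
    rcases abs_choice (t - 2 * a) with habs | habs <;> rw [habs]
    exacts [hirr, hirr.neg]
  refine ⟨a, by exact_mod_cast hpos, abs_pos.2 hirr.ne_zero, lt_of_le_of_ne ?_ habs.ne_one, habs⟩
  calc |t - 2 * a| = 2 * |t / 2 - a| := by
        rw [show t - 2 * a = 2 * (t / 2 - a) by ring, abs_mul, abs_two]
    _ ≤ 1 := by linarith

theorem exists_even_division {p q : ℝ} (hq : 0 < q) (hqp : q < p) (h : Irrational (p / q)) :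
    ∃ s : ℝ, 0 < s ∧ s < q ∧ Irrational (q / s) ∧
      ∃ a : ℕ, 1 ≤ a ∧ (p = 2 * a * q + s ∨ p = 2 * a * q - s) := by
  obtain ⟨a, ha, hpos, hlt, hirr⟩ := exists_abs_sub_even_lt_one ((one_lt_div hq).2 hqp) h
  have hp : p = p / q * q := (div_mul_cancel₀ p hq.ne').symm
  refine ⟨|p / q - 2 * a| * q, mul_pos hpos hq, mul_lt_of_lt_one_left hq hlt, ?_, a, ha, ?_⟩
  · rw [div_mul_cancel_right₀ hq.ne']
    exact hirr.inv
  · rcases abs_choice (p / q - 2 * a) with habs | habs <;> rw [habs]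
    · exact Or.inl (by linear_combination hp)
    · exact Or.inr (by linear_combination hp)

theorem exists_isEvenEuclid {p q : ℝ} (hq : 0 < q) (hqp : q < p) (h : Irrational (p / q)) :
    ∃ r, IsEvenEuclid r ∧ r 0 = p ∧ r 1 = q := by
  let Dividable := {u : ℝ × ℝ // 0 < u.2 ∧ u.2 < u.1 ∧ Irrational (u.1 / u.2)}
  have hdivide (u : Dividable) : ∃ w : Dividable, w.1.1 = u.1.2 ∧ ∃ a : ℕ, 1 ≤ a ∧
      (u.1.1 = 2 * a * u.1.2 + w.1.2 ∨ u.1.1 = 2 * a * u.1.2 - w.1.2) := by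
    obtain ⟨⟨p, q⟩, hq, hqp, h⟩ := u
    obtain ⟨s, hs, hsq, hirr, ha⟩ := exists_even_division hq hqp h
    exact ⟨⟨(q, s), hs, hsq, hirr⟩, rfl, ha⟩
  choose next hfst hnext using hdivide
  let u (n : ℕ) : Dividable := next^[n] ⟨(p, q), hq, hqp, h⟩
  have hu (n : ℕ) : u (n + 1) = next (u n) := Function.iterate_succ_apply' next n _
  have hshift (n : ℕ) : (u (n + 1)).1.1 = (u n).1.2 := by rw [hu, hfst]
  refine ⟨fun n => (u n).1.1, fun k => ⟨?_, ?_, ?_⟩, rfl, hshift 0⟩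
  · exact (u k).2.1.trans_eq (hshift k).symm
  · exact (hshift k).trans_lt (u k).2.2.1
  · simpa only [hshift, hu, hfst] using hnext (u k)

namespace IsEvenEuclid

variable {r : ℕ → ℝ}

theorem pos (hr : IsEvenEuclid r) (k : ℕ) : 0 < r k :=
  (hr k).1.trans (hr k).2.1

theorem antitone (hr : IsEvenEuclid r) : Antitone r :=
  antitone_nat_of_succ_le fun k => (hr k).2.1.le

theorem two_mul_le_add (hr : IsEvenEuclid r) (k : ℕ) : 2 * r (k + 1) ≤ r k + r (k + 2) := by
  obtain ⟨hpos, -, a, ha, h⟩ := hr k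
  have hpos' := hr.pos (k + 2)
  have ha' : (1 : ℝ) ≤ a := by exact_mod_cast ha
  rcases h with h | h <;> nlinarith

theorem two_mul_eq_add (hr : IsEvenEuclid r) {k : ℕ} (h : r k < 2 * r (k + 1)) :
    2 * r (k + 1) = r k + r (k + 2) := by
  obtain ⟨hpos, -, a, ha, hdiv⟩ := hr k
  have hpos' := hr.pos (k + 2)
  have hlt : r (k + 2) < r (k + 1) := (hr (k + 1)).2.1
  have ha' : (1 : ℝ) ≤ a := by exact_mod_cast ha
  rcases hdiv with hdiv | hdiv
  · nlinarith
  obtain rfl : a = 1 := by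
    by_contra hne
    have ha2 : (2 : ℝ) ≤ a := by exact_mod_cast (by omega : 2 ≤ a)
    nlinarith
  push_cast at hdiv
  linarith

theorem antitone_sub (hr : IsEvenEuclid r) : Antitone fun k => r k - r (k + 1) :=
  antitone_nat_of_succ_le fun k => by linarith [hr.two_mul_le_add k]

theorem exists_tendsto (hr : IsEvenEuclid r) : ∃ L, Tendsto r atTop (nhds L) :=
  ⟨_, tendsto_atTop_ciInf hr.antitone ⟨0, Set.forall_mem_range.2 fun k => (hr.pos k).le⟩⟩

theorem frequently_two_mul_le (hr : IsEvenEuclid r) : ∃ᶠ k in atTop, 2 * r (k + 1) ≤ r k := by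
  intro hcon
  simp only [not_le] at hcon
  obtain ⟨n, hn⟩ := eventually_atTop.1 hcon
  have hconst (m : ℕ) : r n - r (n + 1) ≤ r (n + m) - r (n + m + 1) := by
    induction m with
    | zero => rfl
    | succ m ih =>
      have heq := hr.two_mul_eq_add (hn (n + m) (Nat.le_add_right n m))
      rw [← add_assoc]
      linarith
  obtain ⟨L, hL⟩ := hr.exists_tendsto
  have hlim : Tendsto (fun k => r k - r (k + 1)) atTop (nhds 0) := by
    simpa using hL.sub (hL.comp (tendsto_add_atTop_nat 1))
  refine (sub_pos.2 (hr n).2.1).not_ge (ge_of_tendsto hlim (eventually_atTop.2 ⟨n, fun k hk => ?_⟩))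
  obtain ⟨m, rfl⟩ := Nat.exists_eq_add_of_le hk
  exact hconst m

theorem exists_add_mul_lt (hr : IsEvenEuclid r) (C : ℕ) {ε : ℝ} (hε : 0 < ε) :
    ∃ k : ℕ, ((k : ℝ) + C) * r (k + 1) < ε := by
  obtain ⟨L, hL⟩ := hr.exists_tendsto
  have hlim : Tendsto (fun k : ℕ => ((k : ℝ) + C) * (r k - r (k + 1))) atTop (nhds 0) := by
    simpa [add_mul] using (tendsto_mul_sub_succ hL hr.antitone hr.antitone_sub).add
      ((hL.sub (hL.comp (tendsto_add_atTop_nat 1))).const_mul (C : ℝ))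
  obtain ⟨k, hk, hlt⟩ :=
    (hr.frequently_two_mul_le.and_eventually (hlim.eventually_lt_const hε)).exists
  refine ⟨k, lt_of_le_of_lt (mul_le_mul_of_nonneg_left ?_ (by positivity)) hlt⟩
  linarith

end IsEvenEuclid

/-! ### The staircase -/

section Staircase

open Gluing

/-- The surface `S₁`, cut along the chords of slopes `0` and `1` that join vertices of the polygons,
in the linear coordinates `(q - p, -q)`. The pieces are rectangles, and the `n`-th edge is a
diagonal of the `n`-th one. -/
def staircase : Gluing ℤ where
  right n := -1 - n
  top n := -n
  height n := |2 * n + 1|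
  width n := 2 * |(n : ℝ)|
  involutive_right n := sub_sub_cancel _ n
  involutive_top := neg_neg
  height_nonneg _ := abs_nonneg _
  width_nonneg _ := by positivity
  height_right n := by
    rw [← abs_neg]
    push_cast
    ring_nf
  width_top n := by simp

/-- The surface, or its mirror image, in which `block M` is a union of vertical cylinders. -/
noncomputable def stair (M : ℕ) : Gluing ℤ :=
  if Even M then staircase else staircase.swap

/-- The first `M + 1` rectangles of the staircase. -/
def block (M : ℕ) : Set ℤ := Set.Icc (-((M + 1) / 2)) (M / 2)

theorem stair_two_mul (m : ℕ) : stair (2 * m) = staircase :=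
  if_pos (even_two_mul m)

theorem stair_two_mul_add_one (m : ℕ) : stair (2 * m + 1) = staircase.swap :=
  if_neg (Nat.not_even_two_mul_add_one m)

theorem mem_block_two_mul {m : ℕ} {j : ℤ} : j ∈ block (2 * m) ↔ -m ≤ j ∧ j ≤ m := by
  rw [block, Set.mem_Icc]
  push_cast
  omega

theorem mem_block_two_mul_add_one {m : ℕ} {j : ℤ} :
    j ∈ block (2 * m + 1) ↔ -1 - m ≤ j ∧ j ≤ m := by
  rw [block, Set.mem_Icc]
  push_cast
  omega

theorem swap_stair_add_one (M : ℕ) : (stair (M + 1)).swap = stair M := by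
  obtain ⟨m, rfl | rfl⟩ := M.even_or_odd'
  · rw [stair_two_mul_add_one, stair_two_mul]
    rfl
  · rw [show 2 * m + 1 + 1 = 2 * (m + 1) by ring, stair_two_mul, stair_two_mul_add_one]

theorem abs_two_mul_add_one_add_abs {n : ℤ} (hn : n ≠ 0) :
    |2 * (n : ℝ) + 1| + |2 * ((-n : ℤ) : ℝ) + 1| = 2 * (2 * |(n : ℝ)|) := by
  have hint : |2 * n + 1| + |2 * -n + 1| = 2 * (2 * |n|) := by grind
  exact_mod_cast hint

theorem two_mul_abs_add_two_mul_abs (n : ℤ) :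
    2 * |(n : ℝ)| + 2 * |((-1 - n : ℤ) : ℝ)| = 2 * |2 * (n : ℝ) + 1| := by
  have hint : 2 * |n| + 2 * |-1 - n| = 2 * |2 * n + 1| := by grind
  exact_mod_cast hint

theorem halfModulus_stair (M : ℕ) : (stair M).HalfModulus := by
  obtain ⟨m, rfl | rfl⟩ := M.even_or_odd'
  · rw [stair_two_mul]
    intro n
    rcases eq_or_ne n 0 with rfl | hn
    · exact Or.inr (by simp [staircase])
    · exact Or.inl (abs_two_mul_add_one_add_abs hn)
  · rw [stair_two_mul_add_one]
    exact fun n => Or.inl (two_mul_abs_add_two_mul_abs n)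

theorem mapsTo_top_block (M : ℕ) : Set.MapsTo (stair M).top (block M) (block M) := by
  obtain ⟨m, rfl | rfl⟩ := M.even_or_odd' <;> intro j hj
  · rw [stair_two_mul]
    rw [mem_block_two_mul] at hj ⊢
    change -m ≤ -j ∧ -j ≤ m
    omega
  · rw [stair_two_mul_add_one]
    rw [mem_block_two_mul_add_one] at hj ⊢
    change -1 - m ≤ -1 - j ∧ -1 - j ≤ m
    omega

theorem exists_right_mem_block_or_eq (M : ℕ) : ∃ k, (stair M).height k = M + 1 ∧
    ∀ j ∈ block M, (stair M).right j ∈ block M ∨ j = k := by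
  obtain ⟨m, rfl | rfl⟩ := M.even_or_odd'
  · rw [stair_two_mul]
    refine ⟨m, ?_, fun j hj => ?_⟩
    · change |2 * ((m : ℤ) : ℝ) + 1| = (2 * m : ℕ) + 1
      rw [abs_of_nonneg (by positivity)]
      push_cast
      ring
    · rw [mem_block_two_mul] at hj ⊢
      change (-m ≤ -1 - j ∧ -1 - j ≤ m) ∨ j = m
      omega
  · rw [stair_two_mul_add_one]
    refine ⟨-1 - m, ?_, fun j hj => ?_⟩
    · change 2 * |((-1 - m : ℤ) : ℝ)| = (2 * m + 1 : ℕ) + 1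
      rw [abs_of_nonpos (by push_cast; linarith [m.cast_nonneg (α := ℝ)])]
      push_cast
      ring
    · rw [mem_block_two_mul_add_one] at hj ⊢
      change (-1 - m ≤ -j ∧ -j ≤ m) ∨ j = -1 - m
      omega

theorem mapsTo_right_block (M : ℕ) : Set.MapsTo (stair M).right (block M) (block (M + 1)) := by
  obtain ⟨m, rfl | rfl⟩ := M.even_or_odd' <;> intro j hj
  · rw [stair_two_mul]
    rw [mem_block_two_mul] at hj
    rw [mem_block_two_mul_add_one]
    change -1 - m ≤ -1 - j ∧ -1 - j ≤ m
    omega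
  · rw [stair_two_mul_add_one, show 2 * m + 1 + 1 = 2 * (m + 1) by ring]
    rw [mem_block_two_mul_add_one] at hj
    rw [mem_block_two_mul]
    change -((m + 1 : ℕ) : ℤ) ≤ -j ∧ -j ≤ ((m + 1 : ℕ) : ℤ)
    omega

theorem monotone_block : Monotone block := fun M N hMN j hj => by
  simp only [block, Set.mem_Icc] at hj ⊢
  omega

theorem finite_block (M : ℕ) : (block M).Finite :=
  Set.finite_Icc _ _

theorem IsEvenEuclid.almostInvariant (k : ℕ) {M : ℕ} {r : ℕ → ℝ} (hr : IsEvenEuclid r) :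
    (stair M).AlmostInvariant (r 1) (r 0) (block M)
      (ENNReal.ofReal ((k + (M + 1 : ℕ)) * r (k + 1))) := by
  induction k generalizing M r with
  | zero =>
    obtain ⟨last, hlast, hright⟩ := exists_right_mem_block_or_eq M
    simpa [hlast] using almostInvariant_of_forall_right_mem (hr.pos 1).le (hr.pos 0).le
      (finite_block M) (mapsTo_top_block M) hright
  | succ k ih =>
    have hswap := (ih (M := M + 1) (r := fun n => r (n + 1)) fun n => hr (n + 1)).swap
    rw [swap_stair_add_one] at hswap
    have hε : ((k + 1 : ℕ) + (M + 1 : ℕ) : ℝ) = k + (M + 1 + 1 : ℕ) := by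
      push_cast
      ring
    rw [hε]
    have hsub := monotone_block M.le_succ
    obtain ⟨-, -, a, -, hdiv | hdiv⟩ := hr 0
    · rw [hdiv]
      exact hswap.mul_add (halfModulus_stair M) (hr.pos 1) (hr.pos 2).le (finite_block M) hsub
        (mapsTo_top_block M) (mapsTo_right_block M) a
    · have hpos := hr.pos 0
      rw [hdiv] at hpos ⊢
      exact hswap.mul_sub (halfModulus_stair M) (hr.pos 1) (hr.pos 2).le (finite_block M) hsub
        (mapsTo_top_block M) (mapsTo_right_block M) hpos.le

theorem almostInvariant_stair {x y : ℝ} (hx : 0 < x) (hxy : x < y) (h : Irrational (y / x))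
    (M : ℕ) {ε : ℝ≥0∞} (hε : ε ≠ 0) : (stair M).AlmostInvariant x y (block M) ε := by
  obtain ⟨r, hr, rfl, rfl⟩ := exists_isEvenEuclid hx hxy h
  obtain ⟨δ, hδ, hδε⟩ : ∃ δ : ℝ, 0 < δ ∧ ENNReal.ofReal δ ≤ ε := by
    rcases eq_or_ne ε ∞ with rfl | htop
    · exact ⟨1, one_pos, le_top⟩
    · exact ⟨ε.toReal, ENNReal.toReal_pos hε htop, ENNReal.ofReal_toReal_le⟩
  obtain ⟨k, hk⟩ := hr.exists_add_mul_lt (M + 1) hδ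
  exact (hr.almostInvariant k).mono subset_rfl ((ENNReal.ofReal_le_ofReal hk.le).trans hδε)

theorem almostInvariant_staircase {x y : ℝ} (hx : 0 < x) (hy : 0 < y) (h : Irrational (y / x))
    (M : ℕ) {ε : ℝ≥0∞} (hε : ε ≠ 0) : staircase.AlmostInvariant x y (block M) ε := by
  rcases lt_trichotomy x y with hxy | rfl | hyx
  · rw [← stair_two_mul M]
    exact (almostInvariant_stair hx hxy h (2 * M) hε).mono (monotone_block (by omega)) le_rfl
  · exact absurd (div_self hx.ne') h.ne_one
  · have hinv : Irrational (x / y) := by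
      rw [← inv_div]
      exact h.inv
    have hstair := almostInvariant_stair hy hyx hinv (2 * M + 1) hε
    rw [stair_two_mul_add_one] at hstair
    exact hstair.swap.mono (monotone_block (by omega)) le_rfl

theorem conservative_staircase_step {x y : ℝ} (hx : 0 < x) (hy : 0 < y) (h : Irrational (y / x)) :
    Conservative (staircase.step x y) (staircase.flux x y) := by
  refine conservative_of_almost_invariant (measurePreserving_step hx.le hy.le)
    (fun M => Prod.fst ⁻¹' block M) (ae_of_all _ fun z => ⟨2 * z.1.natAbs, ?_⟩) fun M ε hε => ?_
  · rw [Set.mem_preimage, mem_block_two_mul]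
    omega
  · obtain ⟨K, hK, hfin, hsub, hle⟩ := almostInvariant_staircase hx hy h M hε
    exact ⟨K, hK, hsub, flux_ne_top hK hfin, hle⟩

end Staircase

/-! ### Straight rays -/

/-- The sign `1` or `-1` whose multiplication carries the polygon `b` to the upper polygon, and
conversely. -/
def orient (b : Bool) : ℝ := if b then 1 else -1

theorem orient_mul_self (b : Bool) : orient b * orient b = 1 := by
  cases b <;> norm_num [orient]

theorem orient_not (b : Bool) : orient (!b) = -orient b := by cases b <;> simp [orient]

theorem orient_smul_orient_smul (b : Bool) (p : ℝ × ℝ) : orient b • orient b • p = p := by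
  rw [smul_smul, orient_mul_self, one_smul]

theorem mem_polygon_iff {b : Bool} {p : ℝ × ℝ} : p ∈ polygon b ↔ orient b • p ∈ upperPolygon := by
  cases b <;> simp [polygon, orient]

theorem orient_smul_mem_polygon {b : Bool} {p : ℝ × ℝ} :
    orient b • p ∈ polygon b ↔ p ∈ upperPolygon := by
  rw [mem_polygon_iff, orient_smul_orient_smul]

theorem vertex_mem_upperPolygon (n : ℤ) : vertex n ∈ upperPolygon :=
  subset_convexHull ℝ _ ⟨n, rfl⟩

open Classical in
/-- The point of the surface that is represented by a point of the polygon `b`. Outside the polygon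
its value is junk; this makes it a function on the plane. -/
noncomputable def point (b : Bool) (p : ℝ × ℝ) : S₁ :=
  if h : p ∈ polygon b then proj b ⟨p, h⟩ else proj true ⟨vertex 0, vertex_mem_upperPolygon 0⟩

theorem point_of_mem {b : Bool} {p : ℝ × ℝ} (h : p ∈ polygon b) : point b p = proj b ⟨p, h⟩ :=
  dif_pos h

/-- `γ` moves in one of the polygons along a straight segment with velocity `v` during the set `I`
of times. -/
def IsStraightOn (v : ℝ × ℝ) (γ : ℝ → S₁) (I : Set ℝ) : Prop :=
  ∃ (b : Bool) (p : ℝ × ℝ), ∀ t ∈ I, p + t • v ∈ polygon b ∧ γ t = point b (p + t • v)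

/-- A straight-line trajectory with velocity `v` that is defined for nonnegative times. -/
def IsRay (v : ℝ × ℝ) (γ : ℝ → S₁) : Prop :=
  ∀ t : ℝ, 0 ≤ t → γ t ∉ singularities ∧
    (∃ ε > (0 : ℝ), IsStraightOn v γ (Set.Icc t (t + ε))) ∧
    (0 < t → ∃ ε > (0 : ℝ), IsStraightOn v γ (Set.Icc (t - ε) t))

section Ray

variable {v : ℝ × ℝ} {γ γ' : ℝ → S₁} {I J : Set ℝ}

theorem IsStraightOn.mono (h : IsStraightOn v γ I) (hJ : J ⊆ I) : IsStraightOn v γ J :=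
  let ⟨b, p, hp⟩ := h
  ⟨b, p, fun t ht => hp t (hJ ht)⟩

theorem IsStraightOn.congr (h : IsStraightOn v γ I) (hγ : Set.EqOn γ' γ I) :
    IsStraightOn v γ' I :=
  let ⟨b, p, hp⟩ := h
  ⟨b, p, fun t ht => ⟨(hp t ht).1, (hγ ht).trans (hp t ht).2⟩⟩

theorem IsStraightOn.comp_mul_add (h : IsStraightOn v γ I) (a c : ℝ)
    (hJ : ∀ t ∈ J, a * t + c ∈ I) : IsStraightOn (a • v) (fun t => γ (a * t + c)) J := by
  obtain ⟨b, p, hp⟩ := h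
  refine ⟨b, p + c • v, fun t ht => ?_⟩
  have heq : p + c • v + t • a • v = p + (a * t + c) • v := by module
  rw [heq]
  exact hp _ (hJ t ht)

theorem IsStraightOn.exists_proj (h : IsStraightOn v γ I) (t : ℝ) :
    ∃ (b : Bool) (p : ℝ × ℝ), ∀ s ∈ I,
      ∃ h : p + (s - t) • v ∈ polygon b, γ s = proj b ⟨p + (s - t) • v, h⟩ := by
  obtain ⟨b, p, hp⟩ := h
  refine ⟨b, p + t • v, fun s hs => ?_⟩
  have heq : p + t • v + (s - t) • v = p + s • v := by module
  rw [heq]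
  obtain ⟨hmem, hγ⟩ := hp s hs
  exact ⟨hmem, hγ.trans (point_of_mem hmem)⟩

theorem IsRay.congr (h : IsRay v γ) (hγ : Set.EqOn γ' γ (Set.Ici 0)) : IsRay v γ' := by
  intro t ht
  obtain ⟨hsing, ⟨ε, hε, hforward⟩, hbackward⟩ := h t ht
  refine ⟨hγ ht ▸ hsing, ⟨ε, hε, hforward.congr fun s hs => hγ (ht.trans hs.1)⟩, fun htpos => ?_⟩
  obtain ⟨δ, hδ, hstraight⟩ := hbackward htpos
  refine ⟨min δ t, lt_min hδ htpos, (hstraight.mono (Set.Icc_subset_Icc_left ?_)).congr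
    fun s hs => hγ ?_⟩
  · linarith [min_le_left δ t]
  · rw [Set.mem_Ici]
    linarith [hs.1, min_le_right δ t]

theorem IsRay.comp_mul_add (h : IsRay v γ) {a c : ℝ} (ha : 0 < a) (hc : 0 ≤ c) :
    IsRay (a • v) (fun t => γ (a * t + c)) := by
  intro t ht
  obtain ⟨hsing, ⟨ε, hε, hforward⟩, hbackward⟩ := h (a * t + c) (by positivity)
  have hscale (δ : ℝ) : a * (δ / a) = δ := mul_div_cancel₀ δ ha.ne'
  refine ⟨hsing, ⟨ε / a, by positivity, hforward.comp_mul_add a c fun s hs => ?_⟩, fun htpos => ?_⟩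
  · constructor <;> nlinarith [hs.1, hs.2, hscale ε]
  · obtain ⟨δ, hδ, hstraight⟩ := hbackward (by positivity)
    refine ⟨δ / a, by positivity, hstraight.comp_mul_add a c fun s hs => ?_⟩
    constructor <;> nlinarith [hs.1, hs.2, hscale δ]

theorem isTrajectory_of_isRay (hright : IsRay v γ) (hleft : IsRay (-v) fun t => γ (-t)) :
    IsTrajectory v γ := by
  have hneg {t ε δ : ℝ} (h : IsStraightOn (-v) (fun t => γ (-t)) (Set.Icc (-t - δ) (-t + ε))) :
      IsStraightOn v γ (Set.Icc (t - ε) (t + δ)) := by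
    simpa using h.comp_mul_add (-1) 0 (J := Set.Icc (t - ε) (t + δ)) fun s hs =>
      ⟨by linarith [hs.2], by linarith [hs.1]⟩
  have hforward (t : ℝ) : ∃ ε > (0 : ℝ), IsStraightOn v γ (Set.Icc t (t + ε)) := by
    rcases le_or_gt 0 t with ht | ht
    · exact (hright t ht).2.1
    · obtain ⟨ε, hε, h⟩ := (hleft (-t) (by linarith)).2.2 (by linarith)
      exact ⟨ε, hε, by simpa using hneg (ε := 0) (by simpa using h)⟩
  have hbackward (t : ℝ) : ∃ ε > (0 : ℝ), IsStraightOn v γ (Set.Icc (t - ε) t) := by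
    rcases lt_or_ge 0 t with ht | ht
    · exact (hright t ht.le).2.2 ht
    · obtain ⟨ε, hε, h⟩ := (hleft (-t) (by linarith)).2.1
      exact ⟨ε, hε, by simpa using hneg (δ := 0) (by simpa using h)⟩
  have hsing (t : ℝ) : γ t ∉ singularities := by
    rcases le_total 0 t with ht | ht
    · exact (hright t ht).1
    · simpa using (hleft (-t) (by linarith)).1
  intro t
  obtain ⟨ε, hε, hε'⟩ := hforward t
  obtain ⟨δ, hδ, hδ'⟩ := hbackward t
  refine ⟨hsing t, min ε δ, lt_min hε hδ, (hδ'.mono ?_).exists_proj t, (hε'.mono ?_).exists_proj t⟩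
  · exact Set.Icc_subset_Icc_left (by linarith [min_le_right ε δ])
  · exact Set.Icc_subset_Icc_right (by linarith [min_le_left ε δ])

theorem exists_isTrajectory {γ₁ γ₂ : ℝ → S₁} (h₁ : IsRay v γ₁) (h₂ : IsRay (-v) γ₂)
    (h0 : γ₁ 0 = γ₂ 0) :
    ∃ γ, IsTrajectory v γ ∧ ∀ t, 0 ≤ t → γ t = γ₁ t ∧ γ (-t) = γ₂ t := by
  classical
  let γ : ℝ → S₁ := fun t => if 0 ≤ t then γ₁ t else γ₂ (-t)
  have hright {t : ℝ} (ht : 0 ≤ t) : γ t = γ₁ t := if_pos ht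
  have hleft {t : ℝ} (ht : 0 ≤ t) : γ (-t) = γ₂ t := by
    rcases ht.eq_or_lt with rfl | ht
    · rw [neg_zero, hright le_rfl, h0]
    · simp [γ, ht]
  exact ⟨γ, isTrajectory_of_isRay (h₁.congr fun t ht => hright ht) (h₂.congr fun t ht => hleft ht),
    fun t ht => ⟨hright ht, hleft ht⟩⟩

theorem isRay_of_isStraightOn {τ : ℕ → ℝ} (hτ0 : τ 0 = 0) (hτ : StrictMono τ)
    (hτtop : Tendsto τ atTop atTop)
    (hstraight : ∀ n, IsStraightOn v γ (Set.Icc (τ n) (τ (n + 1))))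
    (hsing : ∀ n, ∀ t ∈ Set.Icc (τ n) (τ (n + 1)), γ t ∉ singularities) : IsRay v γ := by
  have hmin (n : ℕ) : τ ⊥ ≤ τ n := hτ.monotone bot_le
  have hunbdd : ¬BddAbove (Set.range τ) := not_bddAbove_of_tendsto_atTop hτtop
  intro t ht
  have hIco : t ∈ ⋃ n, Set.Ico (τ n) (τ (n + 1)) :=
    (iUnion_Ico_map_succ_eq_Ici hmin hunbdd).ge (hτ0.trans_le ht)
  obtain ⟨n, hn⟩ := Set.mem_iUnion.1 hIco
  refine ⟨hsing n t (Set.Ico_subset_Icc_self hn), ⟨τ (n + 1) - t, sub_pos.2 hn.2,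
    (hstraight n).mono (Set.Icc_subset_Icc hn.1 (by linarith))⟩, fun htpos => ?_⟩
  have hIoc : t ∈ ⋃ n, Set.Ioc (τ n) (τ (n + 1)) :=
    (iUnion_Ioc_map_succ_eq_Ioi hmin hunbdd).ge (hτ0.trans_lt htpos)
  obtain ⟨m, hm⟩ := Set.mem_iUnion.1 hIoc
  exact ⟨t - τ m, sub_pos.2 hm.1,
    (hstraight m).mono (Set.Icc_subset_Icc (by linarith) hm.2)⟩

theorem exists_eqOn_Icc_of_strictMono {α : Type*} {τ : ℕ → ℝ} (hτ : StrictMono τ) (f : ℕ → ℝ → α)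
    (hf : ∀ n, f n (τ (n + 1)) = f (n + 1) (τ (n + 1))) :
    ∃ γ, ∀ n, Set.EqOn γ (f n) (Set.Icc (τ n) (τ (n + 1))) := by
  classical
  let γ : ℝ → α := fun t =>
    if h : ∃ n, t ∈ Set.Ico (τ n) (τ (n + 1)) then f h.choose t else f 0 t
  have hγ {n : ℕ} {t : ℝ} (ht : t ∈ Set.Ico (τ n) (τ (n + 1))) : γ t = f n t := by
    have hex : ∃ n, t ∈ Set.Ico (τ n) (τ (n + 1)) := ⟨n, ht⟩
    have hchoose : hex.choose = n :=
      hτ.monotone.pairwise_disjoint_on_Ico_succ.eq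
        (Set.not_disjoint_iff.2 ⟨t, hex.choose_spec, ht⟩)
    simp only [γ, dif_pos hex, hchoose]
  refine ⟨γ, fun n t ht => ?_⟩
  rcases ht.2.eq_or_lt with rfl | hlt
  · rw [hγ (Set.left_mem_Ico.2 (hτ (n + 1).lt_succ_self)), hf]
  · exact hγ ⟨ht.1, hlt⟩

theorem exists_isRay {b : ℕ → Bool} {p : ℕ → ℝ × ℝ} {l : ℕ → ℝ} (hl : ∀ n, 0 < l n)
    (hdiv : Tendsto (fun n => ∑ i ∈ Finset.range n, l i) atTop atTop)
    (hmem : ∀ n, ∀ t ∈ Set.Icc 0 (l n), p n + t • v ∈ polygon (b n))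
    (hsing : ∀ n, ∀ t ∈ Set.Icc 0 (l n), point (b n) (p n + t • v) ∉ singularities)
    (hglue : ∀ n, point (b n) (p n + l n • v) = point (b (n + 1)) (p (n + 1))) :
    ∃ γ, IsRay v γ ∧ ∀ n, ∀ t ∈ Set.Icc 0 (l n),
      γ (∑ i ∈ Finset.range n, l i + t) = point (b n) (p n + t • v) := by
  set τ : ℕ → ℝ := fun n => ∑ i ∈ Finset.range n, l i
  have hτ_succ (n : ℕ) : τ (n + 1) = τ n + l n := Finset.sum_range_succ _ _
  have hτ : StrictMono τ := strictMono_nat_of_lt_succ fun n => by linarith [hl n, hτ_succ n]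
  have hIcc {n : ℕ} {t : ℝ} (ht : t ∈ Set.Icc (τ n) (τ (n + 1))) : t - τ n ∈ Set.Icc 0 (l n) :=
    ⟨by linarith [ht.1], by linarith [ht.2, hτ_succ n]⟩
  obtain ⟨γ, hγ⟩ := exists_eqOn_Icc_of_strictMono hτ (fun n t => point (b n) (p n + (t - τ n) • v))
    fun n => by simp [hτ_succ n, hglue]
  refine ⟨γ, isRay_of_isStraightOn (Finset.sum_range_zero _) hτ hdiv (fun n => ?_)
    (fun n t ht => ?_), fun n t ht => ?_⟩
  · refine ⟨b n, p n - τ n • v, fun t ht => ?_⟩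
    have heq : p n - τ n • v + t • v = p n + (t - τ n) • v := by module
    rw [heq]
    exact ⟨hmem n _ (hIcc ht), hγ n ht⟩
  · rw [hγ n ht]
    exact hsing n _ (hIcc ht)
  · have h := hγ n (x := τ n + t) ⟨by linarith [ht.1], by linarith [ht.2, hτ_succ n]⟩
    simpa using h

end Ray

/-! ### Edges and singularities -/

theorem vertex_mem_edge_iff {m n : ℤ} : vertex m ∈ edge n ↔ m = n ∨ m = n + 1 := by
  constructor
  · rintro ⟨a, c, ha, hc, hac, h⟩
    obtain rfl : a = 1 - c := by linarith
    have hfst : (1 - c) * n + c * (n + 1) = (m : ℝ) := by simpa [vertex] using congrArg Prod.fst h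
    have hle : (n : ℝ) ≤ m := by linarith
    have hle' : (m : ℝ) ≤ n + 1 := by linarith
    have : n ≤ m := by exact_mod_cast hle
    have : m ≤ n + 1 := by exact_mod_cast hle'
    omega
  · rintro (rfl | rfl)
    · exact left_mem_segment ℝ _ _
    · exact right_mem_segment ℝ _ _

theorem edge_subset_upperPolygon (n : ℤ) : edge n ⊆ upperPolygon :=
  (convex_convexHull ℝ _).segment_subset (vertex_mem_upperPolygon n)
    (vertex_mem_upperPolygon (n + 1))

theorem snd_of_mem_edge {n : ℤ} {p : ℝ × ℝ} (h : p ∈ edge n) :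
    p.2 = (2 * n + 1) * p.1 - n * (n + 1) := by
  obtain ⟨a, c, -, -, hac, rfl⟩ := h
  obtain rfl : a = 1 - c := by linarith
  simp only [vertex, Int.cast_add, Int.cast_one, Prod.fst_add, Prod.snd_add, Prod.smul_fst,
    Prod.smul_snd, smul_eq_mul]
  ring

theorem add_sub_mem_edge {n : ℤ} {p : ℝ × ℝ} (h : p ∈ edge n) :
    vertex n + vertex (n + 1) - p ∈ edge n := by
  obtain ⟨a, c, ha, hc, hac, rfl⟩ := h
  refine ⟨c, a, hc, ha, by rw [add_comm, hac], ?_⟩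
  obtain rfl : a = 1 - c := by linarith
  module

theorem exists_add_sub_vertex_eq {m n : ℤ} (h : vertex m ∈ edge n) :
    ∃ k, vertex n + vertex (n + 1) - vertex m = vertex k := by
  rcases vertex_mem_edge_iff.1 h with rfl | rfl
  · exact ⟨m + 1, add_sub_cancel_left _ _⟩
  · exact ⟨n, add_sub_cancel_right _ _⟩

theorem volume_graph {f : ℝ → ℝ} (hf : Measurable f) : volume {p : ℝ × ℝ | p.2 = f p.1} = 0 := by
  have hmeas : MeasurableSet {p : ℝ × ℝ | p.2 = f p.1} :=
    measurableSet_eq_fun measurable_snd (hf.comp measurable_fst)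
  rw [Measure.volume_eq_prod, Measure.measure_prod_null hmeas]
  exact ae_of_all _ fun x => Set.Subsingleton.measure_zero (fun s hs t ht => hs.trans ht.symm) _

theorem volume_edge (n : ℤ) : volume (edge n) = 0 :=
  measure_mono_null (fun _ hp => snd_of_mem_edge hp)
    (volume_graph (f := fun x => (2 * n + 1) * x - n * (n + 1)) (by fun_prop))

theorem measurableSet_edge (n : ℤ) : MeasurableSet (edge n) := by
  rw [edge, ← convexHull_pair]
  exact ((Set.toFinite _).isCompact_convexHull ℝ).isClosed.measurableSet

/-- The point of the upper polygon that corresponds to a point of one of the polygons under the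
rotation. Glued points correspond to points of an edge that are symmetric about its midpoint. -/
def upperPoint (x : Pieces) : ℝ × ℝ := orient x.1 • (x.2 : ℝ × ℝ)

theorem Glue.exists_edge {x y : Pieces} (h : Glue x y) : ∃ n, upperPoint x ∈ edge n ∧
    upperPoint y = vertex n + vertex (n + 1) - upperPoint x := by
  obtain ⟨b, x⟩ := x
  obtain ⟨b', y⟩ := y
  obtain ⟨rfl, rfl, n, hx, hy⟩ := h
  exact ⟨n, by simpa [upperPoint, orient] using hx, by simp_all [upperPoint, orient]⟩

theorem exists_upperPoint_eq_vertex_iff_of_glue {x y : Pieces} (h : Glue x y) :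
    (∃ n, upperPoint x = vertex n) ↔ ∃ n, upperPoint y = vertex n := by
  obtain ⟨n, hx, hy⟩ := h.exists_edge
  constructor
  · rintro ⟨m, hm⟩
    rw [hy, hm]
    exact exists_add_sub_vertex_eq (hm ▸ hx)
  · rintro ⟨m, hm⟩
    rw [← sub_sub_cancel (vertex n + vertex (n + 1)) (upperPoint x), ← hy, hm]
    exact exists_add_sub_vertex_eq (hm ▸ hy ▸ add_sub_mem_edge hx)

theorem mem_singularities_iff {x : Pieces} :
    proj x.1 x.2 ∈ singularities ↔ ∃ n, upperPoint x = vertex n := by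
  have hvertex (b : Bool) (p : ℝ × ℝ) (n : ℤ) :
      (p = if b then vertex n else -vertex n) ↔ orient b • p = vertex n := by
    cases b <;> simp [orient, neg_eq_iff_eq_neg]
  let isVertex : S₁ → Prop := Quot.lift (fun x => ∃ n, upperPoint x = vertex n)
    fun x y h => propext (exists_upperPoint_eq_vertex_iff_of_glue h)
  constructor
  · rintro ⟨b, p, hproj, n, hn⟩
    exact (congrArg isVertex hproj).mpr ⟨n, (hvertex b p n).1 hn⟩
  · rintro ⟨n, hn⟩
    exact ⟨x.1, x.2, rfl, n, (hvertex x.1 x.2 n).2 hn⟩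

theorem point_mem_singularities_iff {b : Bool} {p : ℝ × ℝ} (hp : p ∈ polygon b) :
    point b p ∈ singularities ↔ ∃ n, orient b • p = vertex n := by
  rw [point_of_mem hp]
  exact mem_singularities_iff (x := ⟨b, p, hp⟩)

theorem point_orient_smul_of_mem_edge {n : ℤ} {p : ℝ × ℝ} (hp : p ∈ edge n) (b : Bool) :
    point b (orient b • p) = point (!b) (orient (!b) • (vertex n + vertex (n + 1) - p)) := by
  have hglue {q : ℝ × ℝ} (hq : q ∈ edge n) :
      point true q = point false (-(vertex n + vertex (n + 1) - q)) := by
    have hmem : q ∈ polygon true := edge_subset_upperPolygon n hq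
    have hmem' : -(vertex n + vertex (n + 1) - q) ∈ polygon false := by
      simpa [polygon] using edge_subset_upperPolygon n (add_sub_mem_edge hq)
    rw [point_of_mem hmem, point_of_mem hmem']
    exact Quot.sound ⟨rfl, rfl, n, hq, neg_sub _ _⟩
  cases b
  · simpa [orient] using (hglue (add_sub_mem_edge hp)).symm
  · simpa [orient] using hglue hp

theorem exists_measurableSet_preimage_proj_eq {N : Set (ℝ × ℝ)} (hN : MeasurableSet N) :
    ∃ B : Set S₁, MeasurableSet B ∧
      ∀ b (p : polygon b), proj b p ∈ B ↔ orient b • (p : ℝ × ℝ) ∈ N ∪ ⋃ n, edge n := by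
  let M : Set (ℝ × ℝ) := N ∪ ⋃ n, edge n
  have hM : MeasurableSet M := hN.union (MeasurableSet.iUnion measurableSet_edge)
  have hglue {x y : Pieces} (h : Glue x y) : upperPoint x ∈ M ↔ upperPoint y ∈ M := by
    obtain ⟨n, hx, hy⟩ := h.exists_edge
    exact iff_of_true (Or.inr (Set.mem_iUnion.2 ⟨n, hx⟩))
      (Or.inr (Set.mem_iUnion.2 ⟨n, hy ▸ add_sub_mem_edge hx⟩))
  refine ⟨{x | Quot.lift (fun x => upperPoint x ∈ M) (fun x y h => propext (hglue h)) x},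
    MeasurableSpace.measurableSet_iInf.2 fun b => ?_, fun b p => Iff.rfl⟩
  exact (measurable_subtype_coe.const_smul (orient b)) hM

theorem ae_orient_smul {P : ℝ × ℝ → Prop} (b : Bool) (h : ∀ᵐ p, P p) :
    ∀ᵐ p : ℝ × ℝ, P (orient b • p) := by
  cases b
  · simpa [orient] using (Measure.measurePreserving_neg volume).quasiMeasurePreserving.ae h
  · simpa [orient] using h

theorem ae_area {P : S₁ → Prop}
    (h : ∀ b, ∀ᵐ p : ℝ × ℝ, p ∈ upperPolygon → P (point b (orient b • p))) :
    ∀ᵐ x ∂area, P x := by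
  obtain ⟨N, hsub, hN, hN0⟩ := exists_measurable_superset_of_null (ae_all_iff.2 h)
  obtain ⟨B, hB, hproj⟩ := exists_measurableSet_preimage_proj_eq hN
  have hB0 : area B = 0 := by
    have hnull : ∀ᵐ p, p ∉ N ∪ ⋃ n, edge n :=
      measure_eq_zero_iff_ae_notMem.1 (measure_union_null hN0 (measure_iUnion_null volume_edge))
    rw [area_apply hB]
    refine Finset.sum_eq_zero fun b _ => measure_mono_null ?_ (ae_orient_smul b hnull)
    rintro _ ⟨p, hp, rfl⟩
    exact not_not.2 ((hproj b p).1 hp)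
  refine measure_mono_null (fun x hx => ?_) hB0
  obtain ⟨⟨b, p, hp⟩, rfl⟩ := Quot.exists_rep x
  refine (hproj b ⟨p, hp⟩).2 (Or.inl (hsub fun hgood => hx ?_))
  have hpoint := hgood b (mem_polygon_iff.1 hp)
  rwa [orient_smul_orient_smul, point_of_mem hp] at hpoint

theorem ae_upperPolygon {P : S₁ → Prop} (h : ∀ᵐ x ∂area, P x) (b : Bool) :
    ∀ᵐ p : ℝ × ℝ, p ∈ upperPolygon → P (point b (orient b • p)) := by
  obtain ⟨N, hsub, hN, hN0⟩ := exists_measurable_superset_of_null h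
  rw [area_apply hN, Finset.sum_eq_zero_iff] at hN0
  filter_upwards [ae_orient_smul b
    (measure_eq_zero_iff_ae_notMem.1 (hN0 b (Finset.mem_univ b)))] with p hp hpoly
  by_contra hP
  have hmem := orient_smul_mem_polygon (b := b).2 hpoly
  rw [point_of_mem hmem] at hP
  exact hp ⟨⟨_, hmem⟩, hsub hP, rfl⟩

theorem measurable_of_comp_proj {β : Type*} [MeasurableSpace β] {f : S₁ → β}
    (h : ∀ b, Measurable (f ∘ proj b)) : Measurable f :=
  fun _ hs => MeasurableSpace.measurableSet_iInf.2 fun b => h b hs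

theorem exists_point_eq (x : S₁) : ∃ b, ∃ p ∈ upperPolygon, x = point b (orient b • p) := by
  obtain ⟨⟨b, p, hp⟩, rfl⟩ := Quot.exists_rep x
  refine ⟨b, orient b • p, mem_polygon_iff.1 hp, ?_⟩
  rw [orient_smul_orient_smul, point_of_mem hp]
  rfl

/-! ### Chords of the polygons -/

/-- The polygon that is entered through the edge `n` of the upper polygon or its rotated image by
the flow of slope in `(0, 1)`: in the upper polygon, the edges with `n < 0` are on the left. -/
def side (n : ℤ) : Bool := decide (n < 0)

theorem orient_side_of_neg {n : ℤ} (hn : n < 0) : orient (side n) = 1 := by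
  simp [orient, side, hn]

theorem orient_side_of_nonneg {n : ℤ} (hn : 0 ≤ n) : orient (side n) = -1 := by
  simp [orient, side, hn.not_gt]

theorem orient_side_mul_neg {n : ℤ} {s : ℝ} (hs : s ∈ Set.Ioo (n : ℝ) (n + 1)) :
    orient (side n) * s < 0 := by
  rcases lt_or_ge n 0 with hn | hn
  · have : (n : ℝ) + 1 ≤ 0 := by exact_mod_cast hn
    rw [orient_side_of_neg hn]
    linarith [hs.2]
  · have : (0 : ℝ) ≤ n := by exact_mod_cast hn
    rw [orient_side_of_nonneg hn]
    linarith [hs.1]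

theorem orient_side_mul_sub_slope_pos {α : ℝ} (hα : α ∈ Set.Ioo 0 1) (n : ℤ) :
    0 < orient (side n) * (α - (2 * n + 1)) := by
  rcases lt_or_ge n 0 with hn | hn
  · have : (n : ℝ) + 1 ≤ 0 := by exact_mod_cast hn
    rw [orient_side_of_neg hn]
    linarith [hα.1]
  · have : (0 : ℝ) ≤ n := by exact_mod_cast hn
    rw [orient_side_of_nonneg hn]
    linarith [hα.2]

theorem width_of_neg {n : ℤ} (hn : n < 0) : staircase.width n = -(2 * n) := by
  have : (n : ℝ) < 0 := by exact_mod_cast hn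
  simp only [staircase, abs_of_neg this]
  ring

theorem width_of_nonneg {n : ℤ} (hn : 0 ≤ n) : staircase.width n = 2 * n := by
  have : (0 : ℝ) ≤ n := by exact_mod_cast hn
  simp only [staircase, abs_of_nonneg this]

theorem height_of_neg {n : ℤ} (hn : n < 0) : staircase.height n = -(2 * n + 1) := by
  have : (n : ℝ) + 1 ≤ 0 := by exact_mod_cast hn
  exact abs_of_nonpos (by linarith)

theorem height_of_nonneg {n : ℤ} (hn : 0 ≤ n) : staircase.height n = 2 * n + 1 := by
  have : (0 : ℝ) ≤ n := by exact_mod_cast hn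
  exact abs_of_nonneg (by linarith)

theorem width_mul_add_height_mul (α : ℝ) (n : ℤ) :
    staircase.width n * α + staircase.height n * (1 - α) =
      orient (side n) * (α - (2 * n + 1)) := by
  rcases lt_or_ge n 0 with hn | hn
  · rw [orient_side_of_neg hn, width_of_neg hn, height_of_neg hn]
    ring
  · rw [orient_side_of_nonneg hn, width_of_nonneg hn, height_of_nonneg hn]
    ring

/-- The height above the origin of the line of slope `α` through the `n`-th vertex. -/
def vertexHeight (α : ℝ) (n : ℤ) : ℝ := (n : ℝ) ^ 2 - α * n

/-- The point with abscissa `s` of the line of slope `α` and height `i` above the origin. -/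
def linePoint (α i s : ℝ) : ℝ × ℝ := (s, α * s + i)

/-- The abscissa of the point of the `n`-th edge on the line of slope `α` and height `i`. -/
noncomputable def foot (α : ℝ) (n : ℤ) (i : ℝ) : ℝ := (i + n * (n + 1)) / (2 * n + 1 - α)

/-- The height of the line of slope `α` that a point of the transversal of the staircase stands for.
The `n`-th edge, seen along the direction `(1, α)`, has the same width
`|2 * n + 1 - α| = width n * α + height n * (1 - α)` as the `n`-th rectangle seen along
`(1 - α, α)`. -/
noncomputable def chordHeight (α : ℝ) (z : ℤ × ℝ) : ℝ :=
  vertexHeight α (z.1 + 1) + orient (side z.1) * (staircase.width z.1 * α - z.2)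

/-- The first return map of the flow with velocity `(1, α)` to the edges. -/
noncomputable def chordStep (α : ℝ) : ℤ × ℝ → ℤ × ℝ := staircase.step (1 - α) α

/-- The starting point, in the polygon `side z.1`, of the chord that `z` stands for. -/
noncomputable def chordStart (α : ℝ) (z : ℤ × ℝ) : ℝ × ℝ :=
  orient (side z.1) • linePoint α (chordHeight α z) (foot α z.1 (chordHeight α z))

/-- The duration of the passage along the chord that `z` stands for. -/
noncomputable def chordDuration (α : ℝ) (z : ℤ × ℝ) : ℝ :=
  orient (side z.1) *
    (foot α (chordStep α z).1 (chordHeight α z) - foot α z.1 (chordHeight α z))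

section Line

variable {α i s s' t : ℝ} {n : ℤ}

theorem foot_eq_iff (hα : α ∈ Set.Ioo 0 1) :
    foot α n i = s ↔ α * s + i = (2 * n + 1) * s - n * (n + 1) := by
  have hslope : 2 * (n : ℝ) + 1 - α ≠ 0 := fun h => by
    have hpos := orient_side_mul_sub_slope_pos hα n
    rw [← neg_sub, h, neg_zero, mul_zero] at hpos
    exact lt_irrefl _ hpos
  rw [foot, div_eq_iff hslope]
  constructor <;> intro h <;> linear_combination h

theorem linePoint_foot_mem_edge (hα : α ∈ Set.Ioo 0 1)
    (h : foot α n i ∈ Set.Icc (n : ℝ) (n + 1)) : linePoint α i (foot α n i) ∈ edge n := by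
  refine ⟨n + 1 - foot α n i, foot α n i - n, by linarith [h.2], by linarith [h.1], by ring, ?_⟩
  have hline := (foot_eq_iff hα).1 (rfl : foot α n i = _)
  ext
  · simp only [vertex, Prod.smul_mk, smul_eq_mul, Int.cast_add, Int.cast_one, Prod.mk_add_mk,
      linePoint]
    ring
  · simp only [vertex, Prod.smul_mk, smul_eq_mul, Int.cast_add, Int.cast_one, Prod.mk_add_mk,
      linePoint]
    linear_combination -hline

theorem foot_ne_of_ne_vertexHeight (hα : α ∈ Set.Ioo 0 1) (hi : ∀ m, i ≠ vertexHeight α m) :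
    foot α n i ≠ n ∧ foot α n i ≠ n + 1 := by
  constructor <;> rw [ne_eq, foot_eq_iff hα] <;> intro h
  · exact hi n (by rw [vertexHeight]; linear_combination h)
  · exact hi (n + 1) (by rw [vertexHeight]; push_cast; linear_combination h)

theorem foot_vertexHeight_add_sub (hα : α ∈ Set.Ioo 0 1) (n : ℤ) (i : ℝ) :
    foot α n (vertexHeight α n + vertexHeight α (n + 1) - i) = 2 * n + 1 - foot α n i := by
  have hline := (foot_eq_iff hα).1 (rfl : foot α n i = _)
  rw [foot_eq_iff hα]
  simp only [vertexHeight]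
  push_cast
  linear_combination -hline

theorem vertex_add_vertex_sub_linePoint (α i s : ℝ) (n : ℤ) :
    vertex n + vertex (n + 1) - linePoint α i s =
      linePoint α (vertexHeight α n + vertexHeight α (n + 1) - i) (2 * n + 1 - s) := by
  ext <;> simp only [vertex, Int.cast_add, Int.cast_one, Prod.mk_add_mk, linePoint,
    Prod.mk_sub_mk, vertexHeight] <;> ring

theorem linePoint_ne_vertex (hi : ∀ m, i ≠ vertexHeight α m) (s : ℝ) (n : ℤ) :
    linePoint α i s ≠ vertex n := by
  intro h
  obtain ⟨rfl, hsnd⟩ := Prod.ext_iff.1 h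
  refine hi n ?_
  simp only [linePoint, vertex] at hsnd
  rw [vertexHeight]
  linarith

theorem linePoint_mem_upperPolygon_of_mem_uIcc (hs : linePoint α i s ∈ upperPolygon)
    (hs' : linePoint α i s' ∈ upperPolygon) (ht : t ∈ Set.uIcc s s') :
    linePoint α i t ∈ upperPolygon := by
  have hconv : Convex ℝ (linePoint α i ⁻¹' upperPolygon) := by
    have hline : linePoint α i =
        (fun p => (0, i) + p) ∘ LinearMap.toSpanSingleton ℝ (ℝ × ℝ) (1, α) := by
      ext s <;> simp [linePoint, mul_comm, add_comm]
    rw [hline]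
    exact ((convex_convexHull ℝ _).translate_preimage_right (0, i)).linear_preimage _
  exact hconv.ordConnected.uIcc_subset hs hs' ht

theorem le_sub_of_mem_upperPolygon {p : ℝ × ℝ} (hp : p ∈ upperPolygon) {a i : ℝ}
    (h : ∀ n : ℤ, i ≤ (n : ℝ) ^ 2 - a * n) : i ≤ p.2 - a * p.1 := by
  have hconv : Convex ℝ {p : ℝ × ℝ | i ≤ p.2 - a * p.1} :=
    convex_halfSpace_ge (LinearMap.snd ℝ ℝ ℝ - a • LinearMap.fst ℝ ℝ ℝ).isLinear i
  exact convexHull_min (t := {p | i ≤ p.2 - a * p.1}) (Set.range_subset_iff.2 h) hconv hp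

theorem slope_mul_sub_le_of_mem_upperPolygon {p : ℝ × ℝ} (hp : p ∈ upperPolygon) (n : ℤ) :
    (2 * n + 1) * p.1 - n * (n + 1) ≤ p.2 := by
  have hle := le_sub_of_mem_upperPolygon hp (a := 2 * n + 1) (i := -(n * (n + 1))) fun m => by
    have hint : 0 ≤ (m - n) * (m - n - 1) := by
      rcases lt_or_ge n m with h | h
      · exact mul_nonneg (by lia) (by lia)
      · exact mul_nonneg_of_nonpos_of_nonpos (by lia) (by lia)
    have hreal : (0 : ℝ) ≤ (m - n) * (m - n - 1) := by exact_mod_cast hint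
    linarith
  linarith

theorem orient_side_mul_sub_foot_nonneg (hα : α ∈ Set.Ioo 0 1)
    (hs : linePoint α i s ∈ upperPolygon) (n : ℤ) : 0 ≤ orient (side n) * (s - foot α n i) := by
  have hedge := slope_mul_sub_le_of_mem_upperPolygon hs n
  have hline := (foot_eq_iff hα).1 (rfl : foot α n i = _)
  simp only [linePoint] at hedge
  refine nonneg_of_mul_nonneg_left ?_ (orient_side_mul_sub_slope_pos hα n)
  have hprod : orient (side n) * (s - foot α n i) * (orient (side n) * (α - (2 * n + 1))) =
      (s - foot α n i) * (α - (2 * n + 1)) := by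
    linear_combination (s - foot α n i) * (α - (2 * n + 1)) * orient_mul_self (side n)
  rw [hprod]
  linarith

end Line

section Chord

variable {α : ℝ} {z : ℤ × ℝ} {b : Bool} {p : ℝ × ℝ} {i s : ℝ} {n : ℤ}

theorem foot_chordHeight (hα : α ∈ Set.Ioo 0 1) (z : ℤ × ℝ) :
    foot α z.1 (chordHeight α z) = z.1 + 1 - (staircase.width z.1 * α - z.2) /
      (staircase.width z.1 * α + staircase.height z.1 * (1 - α)) := by
  have hpos := orient_side_mul_sub_slope_pos hα z.1
  have hcancel := div_mul_cancel₀ (staircase.width z.1 * α - z.2) hpos.ne'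
  set q := (staircase.width z.1 * α - z.2) / (orient (side z.1) * (α - (2 * z.1 + 1))) with hq
  rw [foot_eq_iff hα, width_mul_add_height_mul, ← hq, chordHeight, vertexHeight]
  push_cast
  linear_combination
    q * (α - (2 * z.1 + 1)) * orient_mul_self (side z.1) - orient (side z.1) * hcancel

theorem foot_chordHeight_mem_Icc (hα : α ∈ Set.Ioo 0 1) (hz : z ∈ staircase.strip (1 - α) α) :
    foot α z.1 (chordHeight α z) ∈ Set.Icc (z.1 : ℝ) (z.1 + 1) := by
  have hpos := width_mul_add_height_mul α z.1 ▸ orient_side_mul_sub_slope_pos hα z.1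
  have hnonneg : 0 ≤ (staircase.width z.1 * α - z.2) /
      (staircase.width z.1 * α + staircase.height z.1 * (1 - α)) :=
    div_nonneg (by linarith [hz.2]) hpos.le
  have hle : (staircase.width z.1 * α - z.2) /
      (staircase.width z.1 * α + staircase.height z.1 * (1 - α)) ≤ 1 :=
    (div_le_one hpos).2 (by linarith [hz.1])
  rw [foot_chordHeight hα]
  constructor <;> linarith

theorem exists_chordHeight_eq (hα : α ∈ Set.Ioo 0 1)
    (hn : foot α n i ∈ Set.Ioo (n : ℝ) (n + 1)) :
    ∃ c, (n, c) ∈ staircase.strip (1 - α) α ∧ chordHeight α (n, c) = i := by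
  have hpos := orient_side_mul_sub_slope_pos hα n
  have hwidth := width_mul_add_height_mul α n
  have hline := (foot_eq_iff hα).1 (rfl : foot α n i = _)
  set w := orient (side n) * (α - (2 * n + 1))
  refine ⟨staircase.width n * α - (n + 1 - foot α n i) * w, ⟨?_, ?_⟩, ?_⟩
  · dsimp only
    nlinarith [hn.1]
  · dsimp only
    nlinarith [hn.2]
  · simp only [chordHeight, vertexHeight, w]
    push_cast
    linear_combination
      (n + 1 - foot α n i) * (α - (2 * n + 1)) * orient_mul_self (side n) - hline

theorem mapsTo_chordStep (hα : α ∈ Set.Ioo 0 1) :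
    Set.MapsTo (chordStep α) (staircase.strip (1 - α) α) (staircase.strip (1 - α) α) :=
  Gluing.mapsTo_step (sub_nonneg.2 hα.2.le) hα.1.le

theorem chordStep_eq (hz : z ∈ staircase.strip (1 - α) α) :
    chordStep α z = (-1 - z.1, z.2 - staircase.width z.1 * α) ∨
      z.1 ≠ 0 ∧ chordStep α z = (-z.1, z.2 + staircase.height z.1 * (1 - α)) := by
  rcases lt_or_ge (staircase.width z.1 * α - staircase.height z.1 * (1 - α)) z.2 with h | h
  · exact Or.inl (Gluing.step_of_lt h)
  · refine Or.inr ⟨fun h0 => ?_, Gluing.step_of_le h⟩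
    have hwidth : staircase.width z.1 = 0 := by simp [staircase, h0]
    rw [hwidth] at h
    linarith [hz.1]

theorem side_chordStep (hz : z ∈ staircase.strip (1 - α) α) :
    side (chordStep α z).1 = !side z.1 := by
  rcases chordStep_eq hz with h | ⟨h0, h⟩ <;> rw [h] <;> simp only [side] <;> grind

theorem orient_side_chordStep (hz : z ∈ staircase.strip (1 - α) α) :
    orient (side (chordStep α z).1) = -orient (side z.1) := by
  rw [side_chordStep hz, orient_not]

theorem chordHeight_chordStep (hz : z ∈ staircase.strip (1 - α) α) :
    chordHeight α (chordStep α z) = vertexHeight α (chordStep α z).1 +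
      vertexHeight α ((chordStep α z).1 + 1) - chordHeight α z := by
  have horient := orient_side_chordStep hz
  rcases chordStep_eq hz with h | ⟨h0, h⟩ <;> rw [h] at horient ⊢ <;>
    simp only [chordHeight, vertexHeight, horient] <;> push_cast
  · rcases lt_or_ge z.1 0 with hn | hn
    · rw [orient_side_of_neg hn, width_of_neg hn, width_of_nonneg (by lia)]
      push_cast
      ring
    · rw [orient_side_of_nonneg hn, width_of_nonneg hn, width_of_neg (by lia)]
      push_cast
      ring
  · rcases h0.lt_or_gt with hn | hn
    · rw [orient_side_of_neg hn, height_of_neg hn, width_of_nonneg (by lia), width_of_neg hn]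
      push_cast
      ring
    · rw [orient_side_of_nonneg hn.le, height_of_nonneg hn.le, width_of_neg (by lia),
        width_of_nonneg hn.le]
      push_cast
      ring

theorem foot_chordStep_mem_Icc (hα : α ∈ Set.Ioo 0 1) (hz : z ∈ staircase.strip (1 - α) α) :
    foot α (chordStep α z).1 (chordHeight α z) ∈
      Set.Icc ((chordStep α z).1 : ℝ) ((chordStep α z).1 + 1) := by
  have hmem := foot_chordHeight_mem_Icc hα (mapsTo_chordStep hα hz)
  rw [chordHeight_chordStep hz, foot_vertexHeight_add_sub hα] at hmem
  constructor <;> linarith [hmem.1, hmem.2]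

theorem chordStart_add_smul (α : ℝ) (z : ℤ × ℝ) (t : ℝ) :
    chordStart α z + t • ((1, α) : ℝ × ℝ) = orient (side z.1) • linePoint α (chordHeight α z)
      (foot α z.1 (chordHeight α z) + orient (side z.1) * t) := by
  have hsq := orient_mul_self (side z.1)
  ext
  · simp only [chordStart, linePoint, Prod.smul_mk, smul_eq_mul, mul_one, Prod.mk_add_mk]
    linear_combination -t * hsq
  · simp only [chordStart, linePoint, Prod.smul_mk, smul_eq_mul, mul_one, Prod.mk_add_mk]
    linear_combination -t * α * hsq

theorem linePoint_mem_upperPolygon_of_mem_chord (hα : α ∈ Set.Ioo 0 1)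
    (hz : z ∈ staircase.strip (1 - α) α) {t : ℝ} (ht : t ∈ Set.Icc 0 (chordDuration α z)) :
    linePoint α (chordHeight α z) (foot α z.1 (chordHeight α z) + orient (side z.1) * t) ∈
      upperPolygon := by
  refine linePoint_mem_upperPolygon_of_mem_uIcc
    (edge_subset_upperPolygon _ (linePoint_foot_mem_edge hα (foot_chordHeight_mem_Icc hα hz)))
    (edge_subset_upperPolygon _ (linePoint_foot_mem_edge hα (foot_chordStep_mem_Icc hα hz))) ?_
  obtain ⟨h0, hle⟩ := ht
  rw [chordDuration] at hle
  rw [Set.mem_uIcc]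
  rcases lt_or_ge z.1 0 with hn | hn
  · rw [orient_side_of_neg hn] at hle ⊢
    left
    constructor <;> linarith
  · rw [orient_side_of_nonneg hn] at hle ⊢
    right
    constructor <;> linarith

theorem chord_mem_polygon (hα : α ∈ Set.Ioo 0 1) (hz : z ∈ staircase.strip (1 - α) α) {t : ℝ}
    (ht : t ∈ Set.Icc 0 (chordDuration α z)) :
    chordStart α z + t • ((1, α) : ℝ × ℝ) ∈ polygon (side z.1) := by
  rw [chordStart_add_smul, orient_smul_mem_polygon]
  exact linePoint_mem_upperPolygon_of_mem_chord hα hz ht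

theorem point_chord_notMem_singularities (hα : α ∈ Set.Ioo 0 1)
    (hz : z ∈ staircase.strip (1 - α) α) (hgood : ∀ m, chordHeight α z ≠ vertexHeight α m)
    {t : ℝ} (ht : t ∈ Set.Icc 0 (chordDuration α z)) :
    point (side z.1) (chordStart α z + t • ((1, α) : ℝ × ℝ)) ∉ singularities := by
  rw [point_mem_singularities_iff (chord_mem_polygon hα hz ht), chordStart_add_smul,
    orient_smul_orient_smul]
  exact not_exists.2 (linePoint_ne_vertex hgood _)

theorem chordDuration_pos (hα : α ∈ Set.Ioo 0 1) (hz : z ∈ staircase.strip (1 - α) α)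
    (hgood : ∀ m, chordHeight α z ≠ vertexHeight α m) : 0 < chordDuration α z := by
  have hIoo {n : ℤ} (hn : foot α n (chordHeight α z) ∈ Set.Icc (n : ℝ) (n + 1)) :
      foot α n (chordHeight α z) ∈ Set.Ioo (n : ℝ) (n + 1) :=
    let ⟨hne, hne'⟩ := foot_ne_of_ne_vertexHeight hα hgood
    ⟨hn.1.lt_of_ne' hne, hn.2.lt_of_ne hne'⟩
  have hstart := orient_side_mul_neg (hIoo (foot_chordHeight_mem_Icc hα hz))
  have hend := orient_side_mul_neg (hIoo (foot_chordStep_mem_Icc hα hz))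
  rw [orient_side_chordStep hz] at hend
  rw [chordDuration]
  linarith

theorem point_chord_end (hα : α ∈ Set.Ioo 0 1) (hz : z ∈ staircase.strip (1 - α) α) :
    point (side z.1) (chordStart α z + chordDuration α z • ((1, α) : ℝ × ℝ)) =
      point (side (chordStep α z).1) (chordStart α (chordStep α z)) := by
  rw [chordStart_add_smul, chordDuration, ← mul_assoc, orient_mul_self, one_mul, add_sub_cancel,
    point_orient_smul_of_mem_edge (linePoint_foot_mem_edge hα (foot_chordStep_mem_Icc hα hz)),
    vertex_add_vertex_sub_linePoint, chordStart, chordHeight_chordStep hz, side_chordStep hz,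
    foot_vertexHeight_add_sub hα]

theorem foot_mem_Ioo (hα : α ∈ Set.Ioo 0 1) (hn : 0 < orient (side n) * (vertexHeight α n - i))
    (hn' : 0 < orient (side n) * (i - vertexHeight α (n + 1))) :
    foot α n i ∈ Set.Ioo (n : ℝ) (n + 1) := by
  have hpos := orient_side_mul_sub_slope_pos hα n
  have hline := (foot_eq_iff hα).1 (rfl : foot α n i = _)
  rw [vertexHeight] at hn hn'
  push_cast at hn'
  constructor <;> rw [← sub_pos] <;> refine pos_of_mul_pos_left ?_ hpos.le
  · linear_combination hn - orient (side n) * hline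
  · linear_combination hn' + orient (side n) * hline

theorem vertexHeight_nonneg (hα : α ∈ Set.Ioo 0 1) (n : ℤ) : 0 ≤ vertexHeight α n := by
  rw [vertexHeight]
  rcases lt_or_ge 0 n with hn | hn
  · have : (1 : ℝ) ≤ n := by exact_mod_cast hn
    nlinarith [hα.2]
  · have : (n : ℝ) ≤ 0 := by exact_mod_cast hn
    nlinarith [hα.1]

theorem exists_vertexHeight_lt_lt (hα : α ∈ Set.Ioo 0 1) (hi : 0 ≤ i)
    (hgood : ∀ m, i ≠ vertexHeight α m) {ε : ℤ} (hε : ε * ε = 1) :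
    ∃ k : ℕ, vertexHeight α (ε * k) < i ∧ i < vertexHeight α (ε * (k + 1)) := by
  set f : ℕ → ℝ := fun k => vertexHeight α (ε * k) with hf
  have hge (k : ℕ) : (k : ℝ) ^ 2 - k ≤ f k := by
    have hε' : (ε : ℝ) * ε = 1 := by exact_mod_cast hε
    have hle : α * ε * k ≤ 1 * k :=
      mul_le_mul_of_nonneg_right (by nlinarith [hα.1, hα.2, sq_nonneg ((ε : ℝ) - 1)]) k.cast_nonneg
    simp only [hf, vertexHeight]
    push_cast
    linear_combination hle - (k : ℝ) ^ 2 * hε'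
  have hlim : Tendsto f atTop atTop := by
    refine tendsto_atTop_mono' _ ?_ (tendsto_natCast_atTop_atTop (R := ℝ))
    filter_upwards [eventually_ge_atTop 2] with k hk
    have : (2 : ℝ) ≤ k := by exact_mod_cast hk
    nlinarith [hge k]
  have hzero : f ⊥ = 0 := by simp [hf, vertexHeight]
  have hmem : i ∈ Set.Ici (f ⊥) := hzero.trans_le hi
  rw [← iUnion_Ico_map_succ_eq_Ici (fun k => hzero.trans_le (vertexHeight_nonneg hα _))
    (not_bddAbove_of_tendsto_atTop hlim)] at hmem
  obtain ⟨k, hk, hk'⟩ := Set.mem_iUnion.1 hmem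
  exact ⟨k, hk.lt_of_ne' (hgood _), by exact_mod_cast hk'⟩

theorem exists_side_eq_foot_mem_Ioo (hα : α ∈ Set.Ioo 0 1) (hi : 0 ≤ i)
    (hgood : ∀ m, i ≠ vertexHeight α m) (b : Bool) :
    ∃ n, side n = b ∧ foot α n i ∈ Set.Ioo (n : ℝ) (n + 1) := by
  cases b
  · obtain ⟨k, hk, hk'⟩ := exists_vertexHeight_lt_lt hα hi hgood (ε := 1) rfl
    rw [one_mul] at hk hk'
    refine ⟨k, by simp [side], foot_mem_Ioo hα ?_ ?_⟩ <;>
      rw [orient_side_of_nonneg (by lia)] <;> linarith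
  · obtain ⟨k, hk, hk'⟩ := exists_vertexHeight_lt_lt hα hi hgood (ε := -1) rfl
    rw [neg_one_mul] at hk hk'
    refine ⟨-(k + 1), decide_eq_true (by lia), foot_mem_Ioo hα ?_ ?_⟩ <;>
      rw [orient_side_of_neg (by lia)]
    · linarith
    · rw [show -((k : ℤ) + 1) + 1 = -k by ring]
      linarith

theorem exists_chord (hα : α ∈ Set.Ioo 0 1) (hp : p ∈ upperPolygon)
    (hgood : ∀ m, p.2 - α * p.1 ≠ vertexHeight α m) (b : Bool) :
    ∃ z ∈ staircase.strip (1 - α) α, side z.1 = b ∧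
      ∃ t ∈ Set.Icc 0 (chordDuration α z),
        orient b • p = chordStart α z + t • ((1, α) : ℝ × ℝ) := by
  set i := p.2 - α * p.1 with hi
  have hline : p = linePoint α i p.1 := by ext <;> simp [linePoint, hi]
  have hi0 : 0 ≤ i := le_sub_of_mem_upperPolygon hp (vertexHeight_nonneg hα)
  obtain ⟨n, rfl, hn⟩ := exists_side_eq_foot_mem_Ioo hα hi0 hgood b
  obtain ⟨c, hz, hheight⟩ := exists_chordHeight_eq hα hn
  have hstart := orient_side_mul_sub_foot_nonneg hα (hline ▸ hp) n
  have hend := orient_side_mul_sub_foot_nonneg hα (hline ▸ hp) (chordStep α (n, c)).1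
  rw [orient_side_chordStep hz] at hend
  refine ⟨(n, c), hz, rfl, orient (side n) * (p.1 - foot α n i), ⟨hstart, ?_⟩, ?_⟩
  · rw [chordDuration, hheight]
    linarith
  · rw [chordStart_add_smul, hheight, ← mul_assoc, orient_mul_self, one_mul, add_sub_cancel,
      ← hline]

end Chord

/-! ### Recurrence for slopes between zero and one -/

/-- The forward half of recurrence: the trajectories of almost all points of every measurable set
return to the set at arbitrarily large times. -/
def IsForwardRecurrent (v : ℝ × ℝ) : Prop :=
  ∀ A : Set S₁, MeasurableSet A → ∀ᵐ x ∂area, x ∈ A →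
    ∃ γ : ℝ → S₁, IsRay v γ ∧ γ 0 = x ∧ ∃ᶠ t in atTop, γ t ∈ A

section Measurable

variable {α : ℝ}

theorem measurable_comp_fst {β : Type*} [MeasurableSpace β] (f : ℤ → β) :
    Measurable fun z : ℤ × ℝ => f z.1 :=
  (measurable_of_countable f).comp measurable_fst

theorem measurable_chordHeight : Measurable (chordHeight α) :=
  (measurable_comp_fst fun n => vertexHeight α (n + 1)).add <|
    (measurable_comp_fst fun n => orient (side n)).mul <|
      (measurable_comp_fst fun n => staircase.width n * α).sub measurable_snd

theorem measurable_foot_chordHeight {f : ℤ × ℝ → ℤ} (hf : Measurable f) :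
    Measurable fun z => foot α (f z) (chordHeight α z) := by
  have hcast : Measurable fun z => (f z : ℝ) := (measurable_of_countable _).comp hf
  exact (measurable_chordHeight.add (hcast.mul (hcast.add_const 1))).div
    (((hcast.const_mul 2).add_const 1).sub_const α)

theorem measurable_chordDuration : Measurable (chordDuration α) :=
  (measurable_comp_fst fun n => orient (side n)).mul <|
    (measurable_foot_chordHeight (measurable_fst.comp Gluing.measurable_step)).sub
      (measurable_foot_chordHeight measurable_fst)

theorem measurable_chordStart : Measurable (chordStart α) :=
  have hfoot := measurable_foot_chordHeight (α := α) measurable_fst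
  (measurable_comp_fst fun n => orient (side n)).smul
    (hfoot.prodMk ((hfoot.const_mul α).add measurable_chordHeight))

/-- The pairs `(t, z)` such that the point at time `t` of the chord that `z` stands for is in
`A`. -/
def chordVisits (α : ℝ) (A : Set S₁) : Set (ℝ × (ℤ × ℝ)) :=
  {q | q.2 ∈ staircase.strip (1 - α) α ∧ q.1 ∈ Set.Icc 0 (chordDuration α q.2) ∧
    point (side q.2.1) (chordStart α q.2 + q.1 • ((1, α) : ℝ × ℝ)) ∈ A}

theorem measurableSet_chordVisits (hα : α ∈ Set.Ioo 0 1) {A : Set S₁} (hA : MeasurableSet A) :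
    MeasurableSet (chordVisits α A) := by
  have hlift (b : Bool) : ∃ M, MeasurableSet M ∧ Subtype.val ⁻¹' M = proj b ⁻¹' A :=
    measurable_proj b hA
  choose M hM hMA using hlift
  have hiff (q : ℝ × (ℤ × ℝ)) : q ∈ chordVisits α A ↔ q ∈ {q : ℝ × (ℤ × ℝ) |
      q.2 ∈ staircase.strip (1 - α) α ∧ (0 ≤ q.1 ∧ q.1 ≤ chordDuration α q.2) ∧
        ∃ b, side q.2.1 = b ∧ chordStart α q.2 + q.1 • ((1, α) : ℝ × ℝ) ∈ M b} := by
    refine and_congr_right fun hz => and_congr_right fun ht => ?_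
    have hmem := chord_mem_polygon hα hz ht
    have hM := Set.ext_iff.1 (hMA (side q.2.1)) ⟨_, hmem⟩
    rw [point_of_mem hmem, exists_eq_left']
    exact hM.symm
  have hchord : Measurable fun q : ℝ × (ℤ × ℝ) => chordStart α q.2 + q.1 • ((1, α) : ℝ × ℝ) :=
    (measurable_chordStart.comp measurable_snd).add (measurable_fst.smul_const _)
  have hside : Measurable fun q : ℝ × (ℤ × ℝ) => side q.2.1 :=
    (measurable_comp_fst side).comp measurable_snd
  have hmem : MeasurableSet {q : ℝ × (ℤ × ℝ) | ∃ b, side q.2.1 = b ∧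
      chordStart α q.2 + q.1 • ((1, α) : ℝ × ℝ) ∈ M b} := by
    rw [Set.ofPred_exists]
    exact MeasurableSet.iUnion fun b => (hside (measurableSet_singleton b)).inter (hchord (hM b))
  rw [Set.ext hiff]
  exact (measurable_snd Gluing.measurableSet_strip).inter
    (((measurableSet_le measurable_const measurable_fst).inter
      (measurableSet_le measurable_fst (measurable_chordDuration.comp measurable_snd))).inter hmem)

end Measurable

section Recurrence

variable {α : ℝ}

theorem conservative_chordStep (hα : α ∈ Set.Ioo 0 1) (hirr : Irrational α) :
    Conservative (chordStep α) (staircase.flux (1 - α) α) := by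
  refine conservative_staircase_step (sub_pos.2 hα.2) hα.1 ?_
  have heq : α / (1 - α) = (α⁻¹ - (1 : ℤ))⁻¹ := by
    have := hα.1.ne'
    rw [Int.cast_one, inv_eq_one_div α, div_sub_one this, inv_div]
  rw [heq]
  exact (hirr.inv.sub_intCast 1).inv

theorem ae_chordHeight_iterate_ne (hα : α ∈ Set.Ioo 0 1) :
    ∀ᵐ z ∂staircase.flux (1 - α) α, ∀ (n : ℕ) (m : ℤ),
      chordHeight α ((chordStep α)^[n] z) ≠ vertexHeight α m := by
  have hstep : MeasurePreserving (chordStep α) (staircase.flux (1 - α) α)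
      (staircase.flux (1 - α) α) :=
    Gluing.measurePreserving_step (sub_nonneg.2 hα.2.le) hα.1.le
  refine ae_all_iff.2 fun n => ae_all_iff.2 fun m =>
    (hstep.iterate n).quasiMeasurePreserving.ae (p := fun z => chordHeight α z ≠ _) ?_
  filter_upwards [Gluing.ae_ne_flux fun k => staircase.width k * α +
    orient (side k) * (vertexHeight α (k + 1) - vertexHeight α m)] with z hz heq
  rw [chordHeight] at heq
  apply hz
  linear_combination -orient (side z.1) * heq -
    (z.2 - staircase.width z.1 * α) * orient_mul_self (side z.1)

theorem ae_tendsto_sum_chordDuration (hα : α ∈ Set.Ioo 0 1) (hirr : Irrational α) :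
    ∀ᵐ z ∂staircase.flux (1 - α) α, Tendsto
      (fun n => ∑ i ∈ Finset.range n, chordDuration α ((chordStep α)^[i] z)) atTop atTop := by
  have hrec : ∀ᵐ z ∂staircase.flux (1 - α) α, ∀ k : ℕ,
      z ∈ {z | 1 / ((k : ℝ) + 1) < chordDuration α z} →
        ∃ᶠ n in atTop, (chordStep α)^[n] z ∈ {z | 1 / ((k : ℝ) + 1) < chordDuration α z} :=
    ae_all_iff.2 fun k => (conservative_chordStep hα hirr).ae_mem_imp_frequently_image_mem
      (measurableSet_lt measurable_const measurable_chordDuration).nullMeasurableSet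
  filter_upwards [hrec, ae_chordHeight_iterate_ne hα, Gluing.ae_mem_strip] with z hrec hgood hz
  have hpos (n : ℕ) : 0 < chordDuration α ((chordStep α)^[n] z) :=
    chordDuration_pos hα ((mapsTo_chordStep hα).iterate n hz) (hgood n)
  rw [← not_summable_iff_tendsto_nat_atTop_of_nonneg fun n => (hpos n).le]
  intro hsum
  obtain ⟨k, hk⟩ := exists_nat_one_div_lt (hpos 0)
  have hsmall := hsum.tendsto_atTop_zero.eventually_lt_const (u := 1 / ((k : ℝ) + 1))
    (by positivity)
  obtain ⟨n, hlarge, hlt⟩ := ((hrec k hk).and_eventually hsmall).exists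
  exact lt_asymm hlarge hlt

theorem exists_isRay_chord (hα : α ∈ Set.Ioo 0 1) {z : ℤ × ℝ}
    (hz : z ∈ staircase.strip (1 - α) α)
    (hgood : ∀ (n : ℕ) (m : ℤ), chordHeight α ((chordStep α)^[n] z) ≠ vertexHeight α m)
    (hdiv : Tendsto (fun n => ∑ i ∈ Finset.range n, chordDuration α ((chordStep α)^[i] z))
      atTop atTop) :
    ∃ γ, IsRay (1, α) γ ∧ ∀ n, ∀ t ∈ Set.Icc 0 (chordDuration α ((chordStep α)^[n] z)),
      γ (∑ i ∈ Finset.range n, chordDuration α ((chordStep α)^[i] z) + t) =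
        point (side ((chordStep α)^[n] z).1)
          (chordStart α ((chordStep α)^[n] z) + t • ((1, α) : ℝ × ℝ)) := by
  have hstrip (n : ℕ) : (chordStep α)^[n] z ∈ staircase.strip (1 - α) α :=
    (mapsTo_chordStep hα).iterate n hz
  refine exists_isRay (fun n => chordDuration_pos hα (hstrip n) (hgood n)) hdiv
    (fun n t ht => chord_mem_polygon hα (hstrip n) ht)
    (fun n t ht => point_chord_notMem_singularities hα (hstrip n) (hgood n) ht) fun n => ?_
  simp only [Function.iterate_succ_apply']
  exact point_chord_end hα (hstrip n)

theorem volume_image_chord_eq_zero {B : Set (ℝ × (ℤ × ℝ))} (hB : MeasurableSet B)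
    (hB0 : ∀ t, staircase.flux (1 - α) α (Prod.mk t ⁻¹' B) = 0) :
    volume {p : ℝ × ℝ | ∃ z ∈ staircase.strip (1 - α) α, ∃ t, (t, z) ∈ B ∧
      p = chordStart α z + t • ((1, α) : ℝ × ℝ)} = 0 := by
  let C (n : ℤ) : Set (ℝ × ℝ) :=
    {q | (q.1, (n, q.2)) ∈ B ∧ (n, q.2) ∈ staircase.strip (1 - α) α}
  let f (n : ℤ) (q : ℝ × ℝ) : ℝ × ℝ := chordStart α (n, q.2) + q.1 • ((1, α) : ℝ × ℝ)
  have hC (n : ℤ) : volume (C n) = 0 := by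
    have hmeas : MeasurableSet (C n) :=
      ((measurable_fst.prodMk (measurable_const.prodMk measurable_snd)) hB).inter
        ((measurable_const.prodMk measurable_snd) Gluing.measurableSet_strip)
    rw [Measure.volume_eq_prod, Measure.measure_prod_null hmeas]
    refine ae_of_all _ fun t => ?_
    have hzero := hB0 t
    rw [Gluing.flux_apply (measurable_prodMk_left hB), ENNReal.tsum_eq_zero] at hzero
    exact hzero n
  have hf (n : ℤ) : Differentiable ℝ (f n) := by
    simp only [f, chordStart, linePoint, foot, chordHeight]
    fun_prop
  refine measure_mono_null ?_ (measure_iUnion_null fun n =>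
    addHaar_image_eq_zero_of_differentiableOn_of_addHaar_eq_zero volume
      (hf n).differentiableOn (hC n))
  rintro _ ⟨⟨n, c⟩, hz, t, ht, rfl⟩
  exact Set.mem_iUnion.2 ⟨n, (t, c), ⟨ht, hz⟩, rfl⟩

theorem ae_exists_chord (hα : α ∈ Set.Ioo 0 1) {B : Set (ℝ × (ℤ × ℝ))} (hB : MeasurableSet B)
    (hB0 : ∀ t, ∀ᵐ z ∂staircase.flux (1 - α) α, (t, z) ∈ B) (b : Bool) :
    ∀ᵐ p : ℝ × ℝ, p ∈ upperPolygon → ∃ z ∈ staircase.strip (1 - α) α,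
      ∃ t ∈ Set.Icc 0 (chordDuration α z), (t, z) ∈ B ∧ side z.1 = b ∧
        orient b • p = chordStart α z + t • ((1, α) : ℝ × ℝ) := by
  have hheight : ∀ᵐ p : ℝ × ℝ, ∀ m, p.2 - α * p.1 ≠ vertexHeight α m := ae_all_iff.2 fun m => by
    refine measure_mono_null (fun p hp => ?_)
      (volume_graph (f := fun s => α * s + vertexHeight α m) (by fun_prop))
    exact eq_add_of_sub_eq' (not_not.1 hp)
  have hchord := ae_orient_smul b
    (measure_eq_zero_iff_ae_notMem.1 (volume_image_chord_eq_zero hB.compl hB0))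
  filter_upwards [hheight, hchord] with p hgood hchord hp
  obtain ⟨z, hz, hside, t, ht, heq⟩ := exists_chord hα hp hgood b
  exact ⟨z, hz, t, ht, not_not.1 fun hzB => hchord ⟨z, hz, t, hzB, heq⟩, hside, heq⟩

theorem ae_frequently_mem_chordVisits (hα : α ∈ Set.Ioo 0 1) (hirr : Irrational α) {A : Set S₁}
    (hA : MeasurableSet A) (t : ℝ) : ∀ᵐ z ∂staircase.flux (1 - α) α, (t, z) ∈ chordVisits α A →
      ∃ᶠ n in atTop, (t, (chordStep α)^[n] z) ∈ chordVisits α A :=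
  (conservative_chordStep hα hirr).ae_mem_imp_frequently_image_mem
    (measurable_prodMk_left (measurableSet_chordVisits hα hA)).nullMeasurableSet

theorem measurableSet_frequently_mem_chordVisits (hα : α ∈ Set.Ioo 0 1) {A : Set S₁}
    (hA : MeasurableSet A) : MeasurableSet {q : ℝ × (ℤ × ℝ) |
      ∃ᶠ n in atTop, (q.1, (chordStep α)^[n] q.2) ∈ chordVisits α A} := by
  have hlimsup := MeasurableSet.measurableSet_limsup (s := fun n : ℕ =>
    {q : ℝ × (ℤ × ℝ) | (q.1, (chordStep α)^[n] q.2) ∈ chordVisits α A}) fun n =>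
      (measurable_fst.prodMk ((Gluing.measurable_step.iterate n).comp measurable_snd))
        (measurableSet_chordVisits hα hA)
  convert hlimsup using 1
  ext q
  rw [mem_limsup_iff_frequently_mem]
  rfl

theorem isForwardRecurrent_one (hα : α ∈ Set.Ioo 0 1) (hirr : Irrational α) :
    IsForwardRecurrent (1, α) := by
  intro A hA
  obtain ⟨N, hN, hNmeas, hNgood⟩ := ((ae_chordHeight_iterate_ne hα).and
    (ae_tendsto_sum_chordDuration hα hirr)).exists_measurable_mem
  have hmeas := ((measurableSet_chordVisits hα hA).compl.union
    (measurableSet_frequently_mem_chordVisits hα hA)).inter (measurable_snd hNmeas)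
  refine ae_area fun b => ?_
  filter_upwards [ae_exists_chord hα hmeas (fun t => by
    filter_upwards [ae_frequently_mem_chordVisits hα hirr hA t, hN] with z hz hzN
    exact ⟨imp_iff_not_or.1 hz, hzN⟩) b] with p hp hpoly hpA
  obtain ⟨z, hz, t, ht, ⟨hvisit, hzN⟩, rfl, heq⟩ := hp hpoly
  obtain ⟨hgood, hdiv⟩ := hNgood z hzN
  obtain ⟨γ, hγ, hγ_eq⟩ := exists_isRay_chord hα hz hgood hdiv
  have hfreq := imp_iff_not_or.2 hvisit ⟨hz, ht, heq ▸ hpA⟩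
  refine ⟨fun s => γ (1 * s + t), ?_, ?_, ?_⟩
  · simpa only [one_smul] using hγ.comp_mul_add one_pos ht.1
  · have hstart := hγ_eq 0 t ht
    rw [Finset.sum_range_zero] at hstart
    simp only [mul_zero, hstart, heq, Function.iterate_zero_apply]
  · refine hdiv.frequently (hfreq.mono fun n ⟨_, ht, hmem⟩ => ?_)
    simpa only [one_mul, hγ_eq n t ht] using hmem

end Recurrence

/-! ### Symmetries -/

/-- An affine involution of the plane that permutes the edges of the upper polygon, possibly
reversing them. -/
structure IsEdgeInvolution (φ : (ℝ × ℝ) →ᵃ[ℝ] ℝ × ℝ) : Prop where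
  involutive : Function.Involutive φ
  map_edge : ∀ n, ∃ m, (φ (vertex n) = vertex m ∧ φ (vertex (n + 1)) = vertex (m + 1)) ∨
    (φ (vertex n) = vertex (m + 1) ∧ φ (vertex (n + 1)) = vertex m)

theorem isEdgeInvolution_id : IsEdgeInvolution (AffineMap.id ℝ (ℝ × ℝ)) :=
  ⟨fun _ => rfl, fun n => ⟨n, Or.inl ⟨rfl, rfl⟩⟩⟩

/-- The affine involution that maps `(n, n²)` to `(m - n, (m - n)²)`. -/
noncomputable def reflection (m : ℤ) : (ℝ × ℝ) →ᵃ[ℝ] ℝ × ℝ :=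
  AffineMap.const ℝ (ℝ × ℝ) (vertex m) +
    ((-LinearMap.fst ℝ ℝ ℝ).prod
      (LinearMap.snd ℝ ℝ ℝ - (2 * m : ℝ) • LinearMap.fst ℝ ℝ ℝ)).toAffineMap

theorem reflection_apply (m : ℤ) (p : ℝ × ℝ) :
    reflection m p = (m - p.1, m ^ 2 + (p.2 - 2 * m * p.1)) :=
  Prod.ext (sub_eq_add_neg _ _).symm rfl

theorem reflection_linear_one (m : ℤ) (a : ℝ) :
    (reflection m).linear (1, a) = (-1, a - 2 * m) := by
  simp [reflection]

theorem reflection_vertex (m n : ℤ) : reflection m (vertex n) = vertex (m - n) := by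
  rw [reflection_apply]
  ext
  · simp only [vertex, Int.cast_sub]
  · simp only [vertex, Int.cast_sub]
    ring

theorem isEdgeInvolution_reflection (m : ℤ) : IsEdgeInvolution (reflection m) where
  involutive p := by
    simp only [reflection_apply]
    ext <;> ring
  map_edge n := by
    refine ⟨m - (n + 1), Or.inr ?_⟩
    rw [reflection_vertex, reflection_vertex, show m - (n + 1) + 1 = m - n by ring]
    exact ⟨rfl, rfl⟩

section Exchange

variable {φ : (ℝ × ℝ) →ᵃ[ℝ] ℝ × ℝ}

theorem IsEdgeInvolution.exists_vertex_eq (hφ : IsEdgeInvolution φ) (n : ℤ) :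
    ∃ m, φ (vertex n) = vertex m := by
  obtain ⟨m, ⟨h, -⟩ | ⟨h, -⟩⟩ := hφ.map_edge n
  exacts [⟨m, h⟩, ⟨m + 1, h⟩]

theorem IsEdgeInvolution.mapsTo_upperPolygon (hφ : IsEdgeInvolution φ) :
    Set.MapsTo φ upperPolygon upperPolygon := by
  refine convexHull_min (t := φ ⁻¹' upperPolygon) ?_ ((convex_convexHull ℝ _).affine_preimage φ)
  rintro _ ⟨n, rfl⟩
  obtain ⟨m, hm⟩ := hφ.exists_vertex_eq n
  rw [Set.mem_preimage, hm]
  exact vertex_mem_upperPolygon m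

theorem IsEdgeInvolution.exists_edge (hφ : IsEdgeInvolution φ) {n : ℤ} {p : ℝ × ℝ}
    (hp : p ∈ edge n) : ∃ m, φ p ∈ edge m ∧
      φ (vertex n + vertex (n + 1) - p) = vertex m + vertex (m + 1) - φ p := by
  have hsub (a c : ℝ × ℝ) : φ (a + c - p) = φ a + φ c - φ p := by
    rw [show a + c - p = (a - p) + c by abel, ← vadd_eq_add, φ.map_vadd, ← vsub_eq_sub a,
      φ.linearMap_vsub, vadd_eq_add, vsub_eq_sub]
    abel
  have himage : φ p ∈ segment ℝ (φ (vertex n)) (φ (vertex (n + 1))) :=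
    image_segment ℝ φ _ _ ▸ Set.mem_image_of_mem φ hp
  obtain ⟨m, ⟨h, h'⟩ | ⟨h, h'⟩⟩ := hφ.map_edge n
  · exact ⟨m, by rwa [h, h'] at himage, by rw [hsub, h, h']⟩
  · exact ⟨m, by rwa [h, h', segment_symm] at himage, by rw [hsub, h, h', add_comm (vertex m)]⟩

theorem IsEdgeInvolution.ae_comp (hφ : IsEdgeInvolution φ) {P : ℝ × ℝ → Prop} (h : ∀ᵐ p, P p) :
    ∀ᵐ p, P (φ p) := by
  have hdiff : Differentiable ℝ φ :=
    (⟨φ, φ.continuous_of_finiteDimensional⟩ : (ℝ × ℝ) →ᴬ[ℝ] ℝ × ℝ).differentiable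
  have hzero : volume (φ '' {p | ¬P p}) = 0 :=
    addHaar_image_eq_zero_of_differentiableOn_of_addHaar_eq_zero volume hdiff.differentiableOn h
  rwa [hφ.involutive.image_eq_preimage_symm] at hzero

/-- The involution of the surface that exchanges the two polygons and, in terms of the upper
polygon, acts on each of them by `φ`. -/
noncomputable def exchange (hφ : IsEdgeInvolution φ) : S₁ → S₁ :=
  Quot.lift (fun x => point (!x.1) (orient (!x.1) • φ (upperPoint x))) fun x y h => by
    obtain ⟨n, hx, hy⟩ := h.exists_edge
    obtain ⟨m, hmem, hsub⟩ := hφ.exists_edge hx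
    have hside : y.1 = !x.1 := by rw [h.1, h.2.1, Bool.not_true]
    rw [hy, hsub, hside]
    exact point_orient_smul_of_mem_edge hmem _

variable (hφ : IsEdgeInvolution φ)

theorem exchange_point {p : ℝ × ℝ} (hp : p ∈ upperPolygon) (b : Bool) :
    exchange hφ (point b (orient b • p)) = point (!b) (orient (!b) • φ p) := by
  rw [point_of_mem (orient_smul_mem_polygon.2 hp)]
  change point (!b) (orient (!b) • φ (orient b • orient b • p)) = _
  rw [orient_smul_orient_smul]

theorem involutive_exchange : Function.Involutive (exchange hφ) := by
  intro x
  obtain ⟨b, p, hp, rfl⟩ := exists_point_eq x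
  rw [exchange_point hφ hp, exchange_point hφ (hφ.mapsTo_upperPolygon hp), hφ.involutive,
    Bool.not_not]

theorem exchange_mem_singularities {x : S₁} (hx : x ∈ singularities) :
    exchange hφ x ∈ singularities := by
  obtain ⟨b, p, hp, rfl⟩ := exists_point_eq x
  obtain ⟨n, hn⟩ := (point_mem_singularities_iff (orient_smul_mem_polygon.2 hp)).1 hx
  rw [orient_smul_orient_smul] at hn
  rw [exchange_point hφ hp, point_mem_singularities_iff
    (orient_smul_mem_polygon.2 (hφ.mapsTo_upperPolygon hp)), orient_smul_orient_smul, hn]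
  exact hφ.exists_vertex_eq n

theorem measurable_exchange : Measurable (exchange hφ) := by
  refine measurable_of_comp_proj fun b => ?_
  have hmem (p : polygon b) : orient (!b) • φ (orient b • (p : ℝ × ℝ)) ∈ polygon (!b) :=
    orient_smul_mem_polygon.2 (hφ.mapsTo_upperPolygon (mem_polygon_iff.1 p.2))
  have heq : exchange hφ ∘ proj b = fun p => proj (!b) ⟨_, hmem p⟩ :=
    funext fun p => point_of_mem (hmem p)
  rw [heq]
  refine (measurable_proj (!b)).comp (Measurable.subtype_mk ?_)
  exact (φ.continuous_of_finiteDimensional.measurable.comp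
    (measurable_subtype_coe.const_smul (orient b))).const_smul (orient (!b))

theorem ae_exchange {P : S₁ → Prop} (h : ∀ᵐ x ∂area, P x) : ∀ᵐ x ∂area, P (exchange hφ x) := by
  refine ae_area fun b => ?_
  filter_upwards [hφ.ae_comp (ae_upperPolygon h (!b))] with p hP hp
  rw [exchange_point hφ hp]
  exact hP (hφ.mapsTo_upperPolygon hp)

theorem IsStraightOn.exchange {v : ℝ × ℝ} {γ : ℝ → S₁} {I : Set ℝ} (h : IsStraightOn v γ I) :
    IsStraightOn (-φ.linear v) (fun t => exchange hφ (γ t)) I := by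
  obtain ⟨b, p, hp⟩ := h
  refine ⟨!b, orient (!b) • φ (orient b • p), fun t ht => ?_⟩
  obtain ⟨hmem, hγ⟩ := hp t ht
  have hupper := mem_polygon_iff.1 hmem
  have hline : orient (!b) • φ (orient b • p) + t • -φ.linear v =
      orient (!b) • φ (orient b • (p + t • v)) := by
    have hvadd : orient b • (p + t • v) = (orient b * t) • v +ᵥ orient b • p := by
      rw [smul_add, smul_smul, add_comm, vadd_eq_add]
    have hsign : orient (!b) * (orient b * t) = -t := by
      rw [orient_not]
      linear_combination -t * orient_mul_self b
    rw [hvadd, φ.map_vadd, φ.linear.map_smul, vadd_eq_add, smul_add, smul_smul, hsign]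
    module
  rw [hline]
  refine ⟨orient_smul_mem_polygon.2 (hφ.mapsTo_upperPolygon hupper), ?_⟩
  rw [← exchange_point hφ hupper, orient_smul_orient_smul]
  exact congrArg _ hγ

theorem IsRay.exchange {v : ℝ × ℝ} {γ : ℝ → S₁} (h : IsRay v γ) :
    IsRay (-φ.linear v) fun t => exchange hφ (γ t) := by
  intro t ht
  obtain ⟨hsing, ⟨ε, hε, hforward⟩, hbackward⟩ := h t ht
  refine ⟨fun hx => hsing ?_, ⟨ε, hε, hforward.exchange hφ⟩, fun htpos => ?_⟩
  · rw [← involutive_exchange hφ (γ t)]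
    exact exchange_mem_singularities hφ hx
  · obtain ⟨δ, hδ, hstraight⟩ := hbackward htpos
    exact ⟨δ, hδ, hstraight.exchange hφ⟩

theorem IsForwardRecurrent.exchange {v : ℝ × ℝ} (hv : IsForwardRecurrent v)
    (hφ : IsEdgeInvolution φ) : IsForwardRecurrent (-φ.linear v) := by
  intro A hA
  filter_upwards [ae_exchange hφ (hv _ (measurable_exchange hφ hA))] with x hx hxA
  obtain ⟨γ, hγ, hγ0, hfreq⟩ := hx (by rwa [Set.mem_preimage, involutive_exchange hφ x])
  exact ⟨_, hγ.exchange hφ, by rw [hγ0, involutive_exchange hφ x], hfreq⟩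

end Exchange

section Slope

variable {v : ℝ × ℝ}

theorem IsForwardRecurrent.neg (h : IsForwardRecurrent v) : IsForwardRecurrent (-v) := by
  simpa only [AffineMap.id_linear, LinearMap.id_apply] using h.exchange isEdgeInvolution_id

theorem IsForwardRecurrent.two_mul_sub {a : ℝ} (h : IsForwardRecurrent (1, a)) (m : ℤ) :
    IsForwardRecurrent (1, 2 * m - a) := by
  have hreflect := h.exchange (isEdgeInvolution_reflection m)
  rwa [reflection_linear_one, Prod.neg_mk, neg_neg, neg_sub] at hreflect

theorem IsForwardRecurrent.smul (h : IsForwardRecurrent v) {a : ℝ} (ha : 0 < a) :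
    IsForwardRecurrent (a • v) := by
  intro A hA
  filter_upwards [h A hA] with x hx hxA
  obtain ⟨γ, hγ, hγ0, hfreq⟩ := hx hxA
  refine ⟨_, hγ.comp_mul_add ha le_rfl, by rw [mul_zero, zero_add, hγ0], ?_⟩
  refine (tendsto_id.atTop_div_const ha).frequently (hfreq.mono fun t ht => ?_)
  rwa [id, add_zero, mul_div_cancel₀ t ha.ne']

theorem isForwardRecurrent_one_of_irrational {α : ℝ} (hα : Irrational α) :
    IsForwardRecurrent (1, α) := by
  have hlower : ((⌊α⌋ : ℤ) : ℝ) < α := (Int.floor_le α).lt_of_ne fun h => hα ⟨⌊α⌋, by simpa using h⟩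
  have hupper := Int.lt_floor_add_one α
  obtain ⟨k, hk | hk⟩ := Int.even_or_odd' ⌊α⌋
  · rw [hk] at hlower hupper
    push_cast at hlower hupper
    have hfund := isForwardRecurrent_one (α := α - (2 * k : ℤ))
      ⟨by push_cast; linarith, by push_cast; linarith⟩ (hα.sub_intCast _)
    convert (hfund.two_mul_sub 0).two_mul_sub k using 2
    push_cast
    ring
  · rw [hk] at hlower hupper
    push_cast at hlower hupper
    have hfund := isForwardRecurrent_one (α := (2 * (k + 1) : ℤ) - α)
      ⟨by push_cast; linarith, by push_cast; linarith⟩ (hα.intCast_sub _)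
    convert hfund.two_mul_sub (k + 1) using 2
    push_cast
    ring

theorem isForwardRecurrent (hv : v.1 ≠ 0) (hslope : Irrational (v.2 / v.1)) :
    IsForwardRecurrent v := by
  have hone := isForwardRecurrent_one_of_irrational hslope
  have hsmul : v.1 • ((1, v.2 / v.1) : ℝ × ℝ) = v :=
    Prod.ext (mul_one _) (mul_div_cancel₀ _ hv)
  rcases hv.lt_or_gt with hneg | hpos
  · simpa only [neg_smul, neg_neg, hsmul] using (hone.smul (neg_pos.2 hneg)).neg
  · exact hsmul ▸ hone.smul hpos

end Slope

end ParabolaSurface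

theorem mainTheorem5 (v : ℝ × ℝ) (hv : v.1 ≠ 0) (hslope : Irrational (v.2 / v.1)) :
    ParabolaSurface.IsRecurrent v := by
  have hforward := ParabolaSurface.isForwardRecurrent hv hslope
  intro A hA
  filter_upwards [hforward A hA, hforward.neg A hA] with x hright hleft hxA
  obtain ⟨γ₁, hγ₁, hγ₁0, hfreq₁⟩ := hright hxA
  obtain ⟨γ₂, hγ₂, hγ₂0, hfreq₂⟩ := hleft hxA
  obtain ⟨γ, hγ, hγ_eq⟩ := ParabolaSurface.exists_isTrajectory hγ₁ hγ₂ (hγ₁0.trans hγ₂0.symm)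
  refine ⟨γ, hγ, (hγ_eq 0 le_rfl).1.trans hγ₁0, ?_, ?_⟩
  · refine (hfreq₁.and_eventually (eventually_ge_atTop 0)).mono fun t ⟨hmem, ht⟩ => ?_
    exact (hγ_eq t ht).1 ▸ hmem
  · refine tendsto_neg_atTop_atBot.frequently
      ((hfreq₂.and_eventually (eventually_ge_atTop 0)).mono fun t ⟨hmem, ht⟩ => ?_)
    exact (hγ_eq t ht).2 ▸ hmem
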